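/- **Setting.** Let $N\ge 2$ agents $\mathcal N=\{1,\dots,N\}$ act in a multi-agent MDP with state space $\mathcal S$, joint action set $\mathcal A=\prod_i\mathcal A_i$, transition law $P(\cdot\mid s,a)$ and discount factor $\gamma\in[0,1)$. Along a transition $(s,a)\to(s',a')$ agent $i$ receives a local reward $R_i$, which is a measurable function of $(s,a)$ (or, more generally, of $(s,a,s',a')$) with $|R_i|\le r_{\max}$ for a constant $r_{\max}>0$; put $\bar r=\frac1N\sum_i R_i$. Fix a joint policy $\pi$ (for instance a product of local policies $\pi_{\theta_i}$), and let $(s^{(t)},a^{(t)})_{t\ge0}$ be the resulting Markov chain, from any initial distribution of $s^{(0)}$. Assume that it has a stationary distribution $\zeta$ and that $\sup_{s}\|P(s^{(t)},a^{(t)}\mid s^{(0)}=s)-\zeta\|_{TV}\le\kappa\rho^t$ for all $t\ge0$, with constants $\kappa>0$, $\rho\in(0,1)$. The mixing time $\tau(\beta)$ is the least integer $k\ge1$ such that $\sup_s\|P(s^{(t)},a^{(t)}\mid s^{(0)}=s)-\zeta\|_{TV}\le\beta$ for all $t\ge k$. Agent $i$ has a linear critic $V_{w}(s)=\phi_i(s)^\top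 w$, $w\in\mathbb R^d$, with measurable features satisfying $\|\phi_i(s)\|_2\le1$ and linearly independent under $\zeta$, i.e. $\mathbb E_\zeta[(\phi_i(s)^\top u)^2]>0$ for all $u\ne0$. Starting from a given $w_i^{(0)}$, for step size $\beta>0$ and a number $G\ge 0$ of consensus rounds, it updates $$w_i^{(t+1)}=w_i^{(t)}+\beta\Big(\tilde r_i^{(t)}+\gamma\,\phi_i(s^{(t+1)})^\top w_i^{(t)}-\phi_i(s^{(t)})^\top w_i^{(t)}\Big)\phi_i(s^{(t)}),$$ where $\tilde r_i^{(t)}=\tilde r_{i,G}$, $\tilde r_{i,0}$ is the local reward of agent $i$ along the transition from time $t$ to $t+1$, and $\tilde r_{i,g}=\sum_{j\in\mathcal N_i\cup\{i\}}\ell_{ij}\tilde r_{j,g-1}$. Here $\mathcal N_i$ is the set of neighbours of $i$ in a connected undirected communication graph, and $\mathbf L=(\ell_{ij})$ is doubly stochastic with $\ell_{ii}\ge\nu$ for all $i$, $\ell_{ij}\ge\nu$ for neighbours $i,j$, and $\ell_{ij}=0$ for distinct non-neighbours, for a constant $\nu>0$. A TD fixed point of agent $i$ is a $w_i^*$ with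 $\mathbb E_\zeta\big[(\bar r+\gamma\phi_i(s')^\top w_i^*-\phi_i(s)^\top w_i^*)\,\phi_i(s)\big]=0$. **Theorem (finite-time critic convergence rate).** The mixing time satisfies $\tau(\beta)=\mathcal O(\log\beta^{-1})$ as $\beta\downarrow0$, every agent $i$ has exactly one TD fixed point $w_i^*$, and there are constants $\beta_0,c_5,c_6,c_7>0$ with $c_6\beta_0<1$, which do not depend on $\beta$, $t$, $G$, the communication graph, $\mathbf L$, $\nu$ or the distribution of $s^{(0)}$, such that for all $0<\beta\le\beta_0$, all $t,G\ge0$ and all $i\in\mathcal N$ $$\mathbb E\big[\|w_i^{(t)}-w_i^{*}\|^2\big]\le 2\Big(\frac{c_1}{c_3}\Big)^2e^{-2c_2G+2c_4t}+2c_5(1-c_6\beta)^{t-\tau(\beta)}+2c_7\,\tau(\beta)\,\beta,$$ where $c_1=2\beta N r_{\max}(1+\nu^{-(N-1)})$, $c_2=\ln\big((1-\nu^{N-1})^{-1}\big)$, $c_3=(1+\gamma)\beta$ and $c_4=\ln(1+(1+\gamma)\beta)$. -/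

import Mathlib

open MeasureTheory ProbabilityTheory Filter Topology Asymptotics
open scoped BigOperators

noncomputable section

namespace DecMARL

/-! ### The Markov chain of state-action pairs under a fixed policy -/

section Chain

variable {S A : Type*} [MeasurableSpace S] [MeasurableSpace A]

/-- One step of the chain of state-action pairs: from `(s, a)` draw the next state
`s' ∼ P(· | s, a)` and then the next (joint) action `a' ∼ pol(· | s')`. -/
def saStep (P : Kernel (S × A) S) (pol : Kernel S A) : Kernel (S × A) (S × A) :=
  P ⊗ₖ Kernel.prodMkLeft (S × A) pol

instance (P : Kernel (S × A) S) (pol : Kernel S A) [IsMarkovKernel P] [IsMarkovKernel pol] :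
    IsMarkovKernel (saStep P pol) := by
  unfold saStep; infer_instance

/-- `saLaw P pol t s` is the law of `(s⁽ᵗ⁾, a⁽ᵗ⁾)` given `s⁽⁰⁾ = s`. -/
def saLaw (P : Kernel (S × A) S) (pol : Kernel S A) : ℕ → Kernel S (S × A)
  | 0 => Kernel.id ×ₖ pol
  | t + 1 => saStep P pol ∘ₖ saLaw P pol t

instance (P : Kernel (S × A) S) (pol : Kernel S A) [IsMarkovKernel P] [IsMarkovKernel pol]
    (t : ℕ) : IsMarkovKernel (saLaw P pol t) := by
  induction t with
  | zero => unfold saLaw; infer_instance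
  | succ t ih => unfold saLaw; infer_instance

/-- Total variation distance `sup_B |μ(B) - ν(B)|`, over the measurable sets `B`. -/
def tvDist {X : Type*} [MeasurableSpace X] (μ ν : Measure X) : ℝ :=
  ⨆ B : {B : Set X // MeasurableSet B}, |μ.real B - ν.real B|

/-- The mixing time `τ(β)`: the least lag `k ≥ 1` from which on the law of the state-action pair is
within `β` of `ζ` in total variation, uniformly in the initial state. -/
def mixingTime (P : Kernel (S × A) S) (pol : Kernel S A) (ζ : Measure (S × A)) (β : ℝ) : ℕ :=
  sInf {k : ℕ | 1 ≤ k ∧ ∀ t ≥ k, ∀ s : S, tvDist (saLaw P pol t s) ζ ≤ β}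

/-- The random state-action sequence `z t = (s⁽ᵗ⁾, a⁽ᵗ⁾)` is generated by the transition law `P` and
the policy `pol`, from an arbitrary initial distribution of the state: the initial action is drawn
from `pol`, and given the whole past the next pair is drawn from `saStep P pol` at the last pair. -/
structure IsTrajectory (P : Kernel (S × A) S) (pol : Kernel S A)
    {Ω : Type*} [MeasurableSpace Ω] (μ : Measure Ω) (z : ℕ → Ω → S × A) : Prop where
  measurable : ∀ t, Measurable (z t)
  init : μ.map (z 0) = (μ.map fun ω => (z 0 ω).1) ⊗ₘ pol
  step : ∀ t : ℕ,
    μ.map (fun ω => ((fun k : Fin (t + 1) => z k ω), z (t + 1) ω)) =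
      (μ.map fun ω => fun k : Fin (t + 1) => z k ω) ⊗ₘ
        (saStep P pol).comap (fun h : Fin (t + 1) → S × A => h (Fin.last t))
          (measurable_pi_apply _)

end Chain

/-! ### Reward consensus -/

section Consensus

variable {N : ℕ}

/-- The weight matrix `L` is a consensus matrix for the communication graph `Gr` with lower bound
`ν > 0`: it is doubly stochastic, its diagonal entries and the entries of connected pairs are at
least `ν`, and devices that are not linked do not communicate. -/
structure IsConsensusMatrix (Gr : SimpleGraph (Fin N)) (L : Matrix (Fin N) (Fin N) ℝ) (ν : ℝ) :
    Prop where
  pos : 0 < ν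
  doublyStochastic : L ∈ doublyStochastic ℝ (Fin N)
  diag : ∀ i, ν ≤ L i i
  edge : ∀ i j, Gr.Adj i j → ν ≤ L i j
  nonedge : ∀ i j, i ≠ j → ¬ Gr.Adj i j → L i j = 0

open Classical in
/-- One communication round: each agent takes the weighted average of its own value and the values
of its neighbours. -/
def consensusRound (Gr : SimpleGraph (Fin N)) (L : Matrix (Fin N) (Fin N) ℝ)
    (x : Fin N → ℝ) : Fin N → ℝ :=
  fun i => ∑ j with j = i ∨ Gr.Adj i j, L i j * x j

/-- `G` communication rounds. -/
def consensus (Gr : SimpleGraph (Fin N)) (L : Matrix (Fin N) (Fin N) ℝ) (G : ℕ)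
    (x : Fin N → ℝ) : Fin N → ℝ :=
  (consensusRound Gr L)^[G] x

end Consensus

/-! ### The linear TD critic -/

section Critic

variable {N d : ℕ} {S A : Type*}

/-- The critic parameter of agent `i` after `t` updates along the state-action sequence `z`.
At each transition `(s, a) → (s', a')` the local rewards go through `G` rounds of consensus and
agent `i` does the TD(0) update `w ← w + β δ φᵢ(s)` with the TD error
`δ = r̃ᵢ + γ V_w(s') - V_w(s)`, where `V_w(s) = ⟨φᵢ(s), w⟩`. -/
def critic (Gr : SimpleGraph (Fin N)) (L : Matrix (Fin N) (Fin N) ℝ) (G : ℕ)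
    (R : Fin N → S × A → S × A → ℝ) (φ : Fin N → S → EuclideanSpace ℝ (Fin d))
    (γ β : ℝ) (w₀ : Fin N → EuclideanSpace ℝ (Fin d)) (z : ℕ → S × A) (i : Fin N) :
    ℕ → EuclideanSpace ℝ (Fin d)
  | 0 => w₀ i
  | t + 1 =>
    let w := critic Gr L G R φ γ β w₀ z i t
    let r := consensus Gr L G (fun j => R j (z t) (z (t + 1))) i
    let δ := r + γ * inner ℝ (φ i (z (t + 1)).1) w - inner ℝ (φ i (z t).1) w
    w + (β * δ) • φ i (z t).1

/-- `w` is the TD fixed point for the features `f` and the global averaged reward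
`r̄ = (1/N) ∑ⱼ Rⱼ`: in stationarity, `E[(r̄ + γ V_w(s') - V_w(s)) f(s)] = 0`. -/
def IsTDFixedPoint [MeasurableSpace S] [MeasurableSpace A]
    (P : Kernel (S × A) S) (pol : Kernel S A) (ζ : Measure (S × A))
    (R : Fin N → S × A → S × A → ℝ) (f : S → EuclideanSpace ℝ (Fin d)) (γ : ℝ)
    (w : EuclideanSpace ℝ (Fin d)) : Prop :=
  ∫ x, ((∑ j, R j x.1 x.2) / N + γ * inner ℝ (f x.2.1) w - inner ℝ (f x.1.1) w) • f x.1.1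
    ∂(ζ ⊗ₘ saStep P pol) = 0

end Critic

end DecMARL

end

noncomputable section

namespace DecMARL

/-! ### Total variation and integrals of bounded functions -/

section TotalVariation

variable {X : Type*} [MeasurableSpace X]

/-! The critic is compared, path by path, with an ideal TD iteration that receives the exact average
reward. Both share the same random linear part, so their difference is driven only by the consensus
error, which decays like `(1 - ν ^ (N - 1)) ^ G`, and grows by a factor of at most `1 + (1 + γ) * β`
per step. This gives the exponential term (`IsConsensusMatrix.abs_consensus_sub_le`,
`norm_critic_sub_saIter_le`).

Centred at the fixed point, the ideal iteration is `x ↦ x + β (H x + b)` with Markovian noise. Its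
mean matrix is negative definite, by stationarity, `γ < 1` and independence of the features
(`inner_integral_tdLinear_neg`); this also yields existence and uniqueness of the fixed point, where
`b` has mean zero.

The noise is correlated with the iterate. Instead of conditioning a mixing time back, the proof adds
to `‖x‖²` a correction of order `β` built from bounded solutions of Poisson equations, which exist
by geometric mixing (`exists_poisson`). The first-order noise then cancels exactly in conditional
expectation, and the corrected function contracts by `1 - c / 2 * β` up to `O(β²)`
(`IsContractiveSA.integral_lyapunov_le`). Hence the mean square is at most `C (1 - β / C) ^ t + C
β`, which is stronger than needed: the mixing time enters the final bound only through `1 ≤ τ`. The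
two errors combine by `(u + v)² ≤ 2 u² + 2 v²`. -/

theorem abs_measureReal_sub_le_tvDist (μ ν : Measure X) [IsProbabilityMeasure μ]
    [IsProbabilityMeasure ν] {B : Set X} (hB : MeasurableSet B) :
    |μ.real B - ν.real B| ≤ tvDist μ ν := by
  have hbdd : BddAbove (Set.range fun B : {B : Set X // MeasurableSet B} =>
      |μ.real B - ν.real B|) := by
    refine ⟨1, ?_⟩
    rintro _ ⟨B, rfl⟩
    have h1 := measureReal_nonneg (μ := μ) (s := (B : Set X))
    have h2 := measureReal_nonneg (μ := ν) (s := (B : Set X))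
    have h3 : μ.real (B : Set X) ≤ 1 := measureReal_le_one
    have h4 : ν.real (B : Set X) ≤ 1 := measureReal_le_one
    exact abs_le.2 ⟨by linarith, by linarith⟩
  exact le_ciSup hbdd ⟨B, hB⟩

/-- Layer-cake formula: each integral is the integral over levels in `(0, C]` of the measure of a
superlevel set, and at each level the two measures differ by at most the total variation distance.
-/
theorem abs_integral_sub_le_of_nonneg (μ ν : Measure X) [IsProbabilityMeasure μ]
    [IsProbabilityMeasure ν] {f : X → ℝ} (hf : Measurable f) {C : ℝ} (h0 : ∀ x, 0 ≤ f x)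
    (hC : ∀ x, f x ≤ C) : |∫ x, f x ∂μ - ∫ x, f x ∂ν| ≤ C * tvDist μ ν := by
  obtain ⟨x₀⟩ : Nonempty X := nonempty_of_isProbabilityMeasure μ
  have hC0 : 0 ≤ C := (h0 x₀).trans (hC x₀)
  have key : ∀ (η : Measure X) [IsProbabilityMeasure η],
      IntegrableOn (fun t => η.real {x | t < f x}) (Set.Ioc 0 C) ∧
      ∫ x, f x ∂η = ∫ t in Set.Ioc 0 C, η.real {x | t < f x} := by
    intro η _
    have hint : Integrable f η := Integrable.of_bound hf.aestronglyMeasurable C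
      (ae_of_all _ fun x => by rw [Real.norm_eq_abs, abs_of_nonneg (h0 x)]; exact hC x)
    have hanti : Antitone fun t => η.real {x | t < f x} := fun s t hst =>
      measureReal_mono fun x (hx : t < f x) => lt_of_le_of_lt hst hx
    constructor
    · refine Integrable.of_bound hanti.measurable.aestronglyMeasurable 1 (ae_of_all _ fun t => ?_)
      rw [Real.norm_eq_abs, abs_of_nonneg measureReal_nonneg]
      exact measureReal_le_one
    · rw [hint.integral_eq_integral_meas_lt (ae_of_all _ h0)]
      refine setIntegral_eq_of_subset_of_forall_sdiff_eq_zero measurableSet_Ioi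
        Set.Ioc_subset_Ioi_self fun t ht => ?_
      have : {x | t < f x} = ∅ := by
        ext x
        simp only [Set.mem_ofPred_eq, Set.mem_empty_iff_false, iff_false, not_lt]
        by_contra! h
        exact ht.2 ⟨ht.1, h.le.trans (hC x)⟩
      simp [this]
  obtain ⟨hi1, he1⟩ := key μ
  obtain ⟨hi2, he2⟩ := key ν
  rw [he1, he2, ← integral_sub hi1 hi2]
  have := norm_setIntegral_le_of_norm_le_const (μ := volume) (s := Set.Ioc 0 C)
    (f := fun t => μ.real {x | t < f x} - ν.real {x | t < f x}) (C := tvDist μ ν) (by simp)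
    fun t _ => abs_measureReal_sub_le_tvDist μ ν (measurableSet_lt measurable_const hf)
  rw [Real.norm_eq_abs] at this
  refine this.trans (le_of_eq ?_)
  rw [Real.volume_real_Ioc_of_le hC0, sub_zero, mul_comm]

theorem tvDist_nonneg (μ ν : Measure X) : 0 ≤ tvDist μ ν :=
  Real.iSup_nonneg fun _ => abs_nonneg _

theorem norm_integral_sub_le_tvDist {F : Type*} [NormedAddCommGroup F] [NormedSpace ℝ F]
    [CompleteSpace F] (μ ν : Measure X) [IsProbabilityMeasure μ] [IsProbabilityMeasure ν]
    {f : X → F} (hf : StronglyMeasurable f) {C : ℝ} (hC : ∀ x, ‖f x‖ ≤ C) :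
    ‖∫ x, f x ∂μ - ∫ x, f x ∂ν‖ ≤ 2 * C * tvDist μ ν := by
  obtain ⟨x₀⟩ : Nonempty X := nonempty_of_isProbabilityMeasure μ
  have hC0 : 0 ≤ C := (norm_nonneg _).trans (hC x₀)
  have hint : ∀ (η : Measure X) [IsProbabilityMeasure η], Integrable f η := fun η _ =>
    Integrable.of_bound hf.aestronglyMeasurable C (ae_of_all _ hC)
  have htv := tvDist_nonneg μ ν
  refine NormedSpace.norm_le_dual_bound ℝ _ (by positivity) fun l => ?_
  rw [map_sub, ← l.integral_comp_comm (hint μ), ← l.integral_comp_comm (hint ν)]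
  have hb : ∀ x, |l (f x)| ≤ ‖l‖ * C := fun x =>
    (l.le_opNorm _).trans (mul_le_mul_of_nonneg_left (hC x) (norm_nonneg _))
  -- The scalar function `l ∘ f` is shifted by `‖l‖ * C` to become nonnegative; the shift cancels in
  -- the difference because both measures have mass one.
  have h := abs_integral_sub_le_of_nonneg μ ν (f := fun x => l (f x) + ‖l‖ * C)
    (C := 2 * (‖l‖ * C)) ((l.continuous.comp_stronglyMeasurable hf).measurable.add_const _)
    (fun x => by linarith [(abs_le.1 (hb x)).1]) (fun x => by linarith [(abs_le.1 (hb x)).2])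
  rw [integral_add (l.integrable_comp (hint μ)) (integrable_const _),
    integral_add (l.integrable_comp (hint ν)) (integrable_const _)] at h
  simp only [integral_const, probReal_univ, one_smul, add_sub_add_right_eq_sub] at h
  rw [Real.norm_eq_abs]
  refine h.trans (le_of_eq ?_)
  ring

end TotalVariation

/-! ### The Poisson equation of a uniformly ergodic chain -/

section Poisson

variable {Z F : Type*} [MeasurableSpace Z] [NormedAddCommGroup F] [NormedSpace ℝ F]

/-- `iterExp K f k z` is the expectation of `f` after `k` steps of the chain `K` from `z`. -/
def iterExp (K : Kernel Z Z) (f : Z → F) : ℕ → Z → F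
  | 0 => f
  | k + 1 => fun z => ∫ y, iterExp K f k y ∂K z

theorem stronglyMeasurable_iterExp (K : Kernel Z Z) {f : Z → F} (hf : StronglyMeasurable f)
    (k : ℕ) : StronglyMeasurable (iterExp K f k) := by
  induction k with
  | zero => exact hf
  | succ k ih => exact ih.integral_kernel

theorem norm_iterExp_le (K : Kernel Z Z) [IsMarkovKernel K] {f : Z → F} {C : ℝ}
    (hC : ∀ z, ‖f z‖ ≤ C) (k : ℕ) (z : Z) : ‖iterExp K f k z‖ ≤ C := by
  induction k generalizing z with
  | zero => exact hC z
  | succ k ih =>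
    simpa [iterExp] using norm_integral_le_of_norm_le_const (μ := K z) (ae_of_all _ ih)

theorem integrable_of_norm_le {X F : Type*} [MeasurableSpace X] [NormedAddCommGroup F] {f : X → F}
    (hf : StronglyMeasurable f) {C : ℝ} (hC : ∀ x, ‖f x‖ ≤ C) (μ : Measure X)
    [IsFiniteMeasure μ] : Integrable f μ :=
  Integrable.of_bound hf.aestronglyMeasurable C (ae_of_all _ hC)

/-- A bounded solution of the Poisson equation `g - K g = f` exists as soon as the iterated
expectations of `f` decay geometrically. -/
theorem exists_poisson_of_iterExp_le [CompleteSpace F] (K : Kernel Z Z) [IsMarkovKernel K]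
    {f : Z → F} (hf : StronglyMeasurable f) {C D ρ : ℝ} (hρ0 : 0 < ρ) (hρ1 : ρ < 1)
    (hC : ∀ z, ‖f z‖ ≤ C) (hD : ∀ k z, ‖iterExp K f (k + 1) z‖ ≤ D * ρ ^ k) :
    ∃ g : Z → F, StronglyMeasurable g ∧ (∃ a, ∀ z, ‖g z‖ ≤ a) ∧
      ∀ z, g z - ∫ y, g y ∂K z = f z := by
  have hgeo : Summable fun k => D * ρ ^ k :=
    (summable_geometric_of_lt_one hρ0.le hρ1).mul_left D
  have hs1 : ∀ z, Summable fun k => iterExp K f (k + 1) z := fun z =>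
    Summable.of_norm_bounded hgeo fun k => hD k z
  have hs : ∀ z, Summable fun k => iterExp K f k z := fun z =>
    (summable_nat_add_iff 1).1 (hs1 z)
  have hgm : StronglyMeasurable fun z => ∑' k, iterExp K f k z := by
    refine stronglyMeasurable_of_tendsto (u := atTop)
      (f := fun n z => ∑ k ∈ Finset.range n, iterExp K f k z) (fun n => ?_) ?_
    · exact Finset.stronglyMeasurable_fun_sum _ fun k _ => stronglyMeasurable_iterExp K hf k
    · exact tendsto_pi_nhds.2 fun z => (hs z).hasSum.tendsto_sum_nat
  -- The solution is the Neumann series `∑ Kᵏ f`: applying `K` shifts it by one, so only the term `k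
  -- = 0` survives in `g - K g`.
  refine ⟨fun z => ∑' k, iterExp K f k z, hgm, ⟨C + ∑' k, D * ρ ^ k, fun z => ?_⟩, fun z => ?_⟩
  · change ‖∑' k, iterExp K f k z‖ ≤ _
    rw [(hs z).tsum_eq_zero_add]
    exact (norm_add_le _ _).trans (add_le_add (hC z)
      (tsum_of_norm_bounded hgeo.hasSum fun k => hD k z))
  · have hint : ∀ k, Integrable (iterExp K f k) (K z) := fun k =>
      integrable_of_norm_le (stronglyMeasurable_iterExp K hf k) (norm_iterExp_le K hC k) _
    have hsum : Summable fun k => ∫ y, ‖iterExp K f k y‖ ∂K z := by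
      refine (summable_nat_add_iff 1).1 (Summable.of_nonneg_of_le
        (fun k => integral_nonneg fun y => norm_nonneg _) (fun k => ?_) hgeo)
      have := integral_mono (hint (k + 1)).norm (integrable_const _) (hD k)
      simpa using this
    change ∑' k, iterExp K f k z - _ = _
    rw [← integral_tsum_of_summable_integral_norm hint hsum, (hs z).tsum_eq_zero_add]
    simp [iterExp]

variable {S A : Type*} [MeasurableSpace S] [MeasurableSpace A]

theorem integral_saLaw_zero (P : Kernel (S × A) S) (pol : Kernel S A) [IsMarkovKernel P]
    [IsMarkovKernel pol] {f : S × A → F} (hf : StronglyMeasurable f) (s : S) :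
    ∫ y, f y ∂saLaw P pol 0 s = ∫ a, f (s, a) ∂pol s := by
  have : saLaw P pol 0 s = Measure.map (Prod.mk s) (pol s) := by
    rw [saLaw, Kernel.prod_apply, Kernel.id_apply, Measure.dirac_prod]
  rw [this, integral_map measurable_prodMk_left.aemeasurable hf.aestronglyMeasurable]

theorem integral_saStep (P : Kernel (S × A) S) (pol : Kernel S A) [IsMarkovKernel P]
    [IsMarkovKernel pol] {f : S × A → F} (hf : StronglyMeasurable f) {C : ℝ}
    (hC : ∀ z, ‖f z‖ ≤ C) (z : S × A) :
    ∫ y, f y ∂saStep P pol z = ∫ s, ∫ y, f y ∂saLaw P pol 0 s ∂P z := by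
  have h := integral_compProd (κ := P) (η := Kernel.prodMkLeft (S × A) pol) (a := z) (f := f)
    (integrable_of_norm_le hf hC _)
  simp only [Kernel.prodMkLeft_apply] at h
  rw [saStep, h]
  exact integral_congr_ae (ae_of_all _ fun s => (integral_saLaw_zero P pol hf s).symm)

/-- Chapman–Kolmogorov: steps are moved from the law of the chain onto the integrand. -/
theorem integral_saLaw_iterExp (P : Kernel (S × A) S) (pol : Kernel S A) [IsMarkovKernel P]
    [IsMarkovKernel pol] {f : S × A → F} (hf : StronglyMeasurable f) {C : ℝ}
    (hC : ∀ z, ‖f z‖ ≤ C) (k j : ℕ) (s : S) :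
    ∫ y, iterExp (saStep P pol) f j y ∂saLaw P pol k s =
      ∫ y, iterExp (saStep P pol) f (j + k) y ∂saLaw P pol 0 s := by
  induction k generalizing j with
  | zero => rfl
  | succ k ih =>
    have hi : Integrable (iterExp (saStep P pol) f j) ((saStep P pol ∘ₖ saLaw P pol k) s) :=
      integrable_of_norm_le (stronglyMeasurable_iterExp _ hf j) (norm_iterExp_le _ hC j) _
    have he := Kernel.integral_comp hi
    have := ih (j + 1)
    rw [show j + 1 + k = j + (k + 1) by ring] at this
    exact he.trans this

/-- Mixing is assumed from an initial state, not from a state-action pair. One step from a pair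
reaches a fresh state whose action follows `pol`, so `k + 1` steps from a pair inherit the decay of
`k` steps from a state. -/
theorem exists_poisson [CompleteSpace F] (P : Kernel (S × A) S) (pol : Kernel S A)
    [IsMarkovKernel P] [IsMarkovKernel pol] (ζ : Measure (S × A)) [IsProbabilityMeasure ζ]
    {κ ρ : ℝ} (hρ0 : 0 < ρ) (hρ1 : ρ < 1)
    (hmix : ∀ (t : ℕ) (s : S), tvDist (saLaw P pol t s) ζ ≤ κ * ρ ^ t)
    {f : S × A → F} (hf : StronglyMeasurable f) {C : ℝ} (hC : ∀ z, ‖f z‖ ≤ C)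
    (hζf : ∫ z, f z ∂ζ = 0) :
    ∃ g : S × A → F, StronglyMeasurable g ∧ (∃ a, ∀ z, ‖g z‖ ≤ a) ∧
      ∀ z, g z - ∫ y, g y ∂saStep P pol z = f z := by
  refine exists_poisson_of_iterExp_le (saStep P pol) hf (D := 2 * C * κ) hρ0 hρ1 hC fun k z => ?_
  have hC0 : 0 ≤ C := (norm_nonneg _).trans (hC z)
  have hk : ∀ s, ‖∫ y, iterExp (saStep P pol) f k y ∂saLaw P pol 0 s‖ ≤ 2 * C * κ * ρ ^ k := by
    intro s
    have h := integral_saLaw_iterExp P pol hf hC k 0 s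
    rw [zero_add] at h
    rw [← h]
    have h2 := norm_integral_sub_le_tvDist (saLaw P pol k s) ζ hf hC
    rw [hζf, sub_zero] at h2
    refine h2.trans ?_
    rw [mul_assoc (2 * C)]
    exact mul_le_mul_of_nonneg_left (hmix k s) (by positivity)
  have := norm_integral_le_of_norm_le_const (μ := P z) (ae_of_all _ hk)
  change ‖∫ y, iterExp (saStep P pol) f k y ∂saStep P pol z‖ ≤ _
  rw [integral_saStep P pol (stronglyMeasurable_iterExp _ hf k)
    (norm_iterExp_le _ hC k)]
  simpa using this

end Poisson

/-! ### The mixing time -/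

section MixingTime

variable {S A : Type*} [MeasurableSpace S] [MeasurableSpace A]

theorem mixingTime_le {P : Kernel (S × A) S} {pol : Kernel S A} {ζ : Measure (S × A)}
    {κ ρ : ℝ} (hκ : 0 < κ) (hρ0 : 0 < ρ) (hρ1 : ρ < 1)
    (hmix : ∀ (t : ℕ) (s : S), tvDist (saLaw P pol t s) ζ ≤ κ * ρ ^ t) {β : ℝ} {k : ℕ}
    (hk1 : 1 ≤ k) (hk : κ * ρ ^ k ≤ β) : mixingTime P pol ζ β ≤ k :=
  Nat.sInf_le ⟨hk1, fun t ht s => (hmix t s).trans ((mul_le_mul_of_nonneg_left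
    (pow_le_pow_of_le_one hρ0.le hρ1.le ht) hκ.le).trans hk)⟩

/-- The infimum of an empty set of naturals is `0`, so some admissible lag must be exhibited;
geometric decay supplies one. -/
theorem one_le_mixingTime {P : Kernel (S × A) S} {pol : Kernel S A} {ζ : Measure (S × A)}
    {κ ρ : ℝ} (hκ : 0 < κ) (hρ0 : 0 < ρ) (hρ1 : ρ < 1)
    (hmix : ∀ (t : ℕ) (s : S), tvDist (saLaw P pol t s) ζ ≤ κ * ρ ^ t) {β : ℝ} (hβ : 0 < β) :
    1 ≤ mixingTime P pol ζ β := by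
  obtain ⟨n, hn⟩ := exists_pow_lt_of_lt_one (div_pos hβ hκ) hρ1
  rw [lt_div_iff₀' hκ] at hn
  refine (Nat.sInf_mem (s := {k : ℕ | 1 ≤ k ∧ ∀ t ≥ k, ∀ s : S, tvDist (saLaw P pol t s) ζ ≤ β})
    ⟨n + 1, by simp, fun t ht s => (hmix t s).trans ((mul_le_mul_of_nonneg_left
      (pow_le_pow_of_le_one hρ0.le hρ1.le (by omega)) hκ.le).trans hn.le)⟩).1

theorem mixingTime_isBigO_log {P : Kernel (S × A) S} {pol : Kernel S A} {ζ : Measure (S × A)}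
    {κ ρ : ℝ} (hκ : 0 < κ) (hρ0 : 0 < ρ) (hρ1 : ρ < 1)
    (hmix : ∀ (t : ℕ) (s : S), tvDist (saLaw P pol t s) ζ ≤ κ * ρ ^ t) :
    (fun β : ℝ => (mixingTime P pol ζ β : ℝ)) =O[𝓝[>] 0] fun β : ℝ => Real.log (β⁻¹) := by
  have hl : 0 < -Real.log ρ := neg_pos.2 (Real.log_neg hρ0 hρ1)
  have hlarge : Tendsto (fun β : ℝ => Real.log β⁻¹) (𝓝[>] 0) atTop :=
    Real.tendsto_log_atTop.comp tendsto_inv_nhdsGT_zero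
  refine IsBigO.of_bound ((1 + |Real.log κ|) / (-Real.log ρ) + 2) ?_
  filter_upwards [self_mem_nhdsWithin, hlarge.eventually_ge_atTop 1] with β hβ hβ1
  have hβ0 : 0 < β := hβ
  -- Solving `κ * ρ ^ x ≤ β` for `x`, with `|log κ|` in place of `log κ` to keep `x` nonnegative.
  -- The later `+ 1` makes the lag at least `1`.
  set x := (|Real.log κ| + Real.log β⁻¹) / (-Real.log ρ) with hx
  have hx0 : 0 ≤ x := div_nonneg (add_nonneg (abs_nonneg _) (by linarith)) hl.le
  have hk : κ * ρ ^ (⌈x⌉₊ + 1) ≤ β := by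
    rw [← Real.log_le_log_iff (by positivity) hβ0, Real.log_mul hκ.ne' (by positivity),
      Real.log_pow]
    have h1 : x ≤ ((⌈x⌉₊ + 1 : ℕ) : ℝ) := (Nat.le_ceil x).trans (by push_cast; linarith)
    have h2 : x * (-Real.log ρ) ≤ ((⌈x⌉₊ + 1 : ℕ) : ℝ) * (-Real.log ρ) :=
      mul_le_mul_of_nonneg_right h1 hl.le
    have h3 : x * (-Real.log ρ) = |Real.log κ| - Real.log β := by
      rw [hx, div_mul_cancel₀ _ hl.ne', Real.log_inv, sub_eq_add_neg]
    linarith [le_abs_self (Real.log κ)]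
  have h := mixingTime_le hκ hρ0 hρ1 hmix (by omega) hk
  have h' : (mixingTime P pol ζ β : ℝ) ≤ x + 2 := by
    have h3 : (mixingTime P pol ζ β : ℝ) ≤ ((⌈x⌉₊ + 1 : ℕ) : ℝ) := by exact_mod_cast h
    push_cast at h3
    linarith [Nat.ceil_lt_add_one hx0]
  rw [Real.norm_of_nonneg (Nat.cast_nonneg _), Real.norm_of_nonneg (by linarith)]
  refine h'.trans ?_
  have h4 : x ≤ (1 + |Real.log κ|) * Real.log β⁻¹ / (-Real.log ρ) := by
    rw [hx]
    gcongr
    nlinarith [abs_nonneg (Real.log κ)]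
  rw [add_mul, div_mul_eq_mul_div]
  linarith

end MixingTime


/-! ### Linear stochastic approximation driven by a Markov chain -/

section StochasticApproximation

variable {Z E : Type*} [MeasurableSpace Z] [NormedAddCommGroup E] [InnerProductSpace ℝ E]

/-- One step `x ↦ x + β (H x + b)` of linear stochastic approximation. -/
def saUpdate (H : Z → Z → E →L[ℝ] E) (b : Z → Z → E) (β : ℝ) (x : E) (z z' : Z) : E :=
  x + β • (H z z' x + b z z')

/-- The iterates of linear stochastic approximation along a sequence `z`. -/
def saIter (H : Z → Z → E →L[ℝ] E) (b : Z → Z → E) (β : ℝ) (x₀ : E) (z : ℕ → Z) : ℕ → E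
  | 0 => x₀
  | t + 1 => saUpdate H b β (saIter H b β x₀ z t) (z t) (z (t + 1))

/-- The squared norm, corrected by `β` times the solutions of the Poisson equations. -/
def lyapunov (M : Z → E →L[ℝ] E) (m : Z → E) (β : ℝ) (x : E) (z : Z) : ℝ :=
  ‖x‖ ^ 2 + β * (inner ℝ x (M z x) + inner ℝ (m z) x)

/-- The random linear system `(H, b)` driven by the Markov kernel `K` is bounded, has a contractive
mean `Abar`, and `M`, `m` are bounded solutions of the Poisson equations. -/
structure IsContractiveSA (K : Kernel Z Z) (H : Z → Z → E →L[ℝ] E) (b : Z → Z → E)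
    (M : Z → E →L[ℝ] E) (m : Z → E) (Abar : E →L[ℝ] E) (a c : ℝ) : Prop where
  H_meas : StronglyMeasurable (Function.uncurry H)
  b_meas : StronglyMeasurable (Function.uncurry b)
  M_meas : StronglyMeasurable M
  m_meas : StronglyMeasurable m
  one_le : 1 ≤ a
  H_le : ∀ z z', ‖H z z'‖ ≤ a
  b_le : ∀ z z', ‖b z z'‖ ≤ a
  M_le : ∀ z, ‖M z‖ ≤ a
  m_le : ∀ z, ‖m z‖ ≤ a
  c_pos : 0 < c
  drift : ∀ x, inner ℝ x (Abar x) ≤ -c * ‖x‖ ^ 2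
  M_eq : ∀ z, M z - ∫ y, M y ∂K z = (2 : ℝ) • (∫ y, H z y ∂K z - Abar)
  m_eq : ∀ z, m z - ∫ y, m y ∂K z = (2 : ℝ) • ∫ y, b z y ∂K z

variable {K : Kernel Z Z} {H : Z → Z → E →L[ℝ] E} {b : Z → Z → E}
  {M : Z → E →L[ℝ] E} {m : Z → E} {Abar : E →L[ℝ] E} {a c β : ℝ}

omit [MeasurableSpace Z] in
theorem abs_lyapunov_sub_sq_le (hM : ∀ z, ‖M z‖ ≤ a) (hm : ∀ z, ‖m z‖ ≤ a)
    (hβ : 0 ≤ β) (x : E) (z : Z) :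
    |lyapunov M m β x z - ‖x‖ ^ 2| ≤ β * (a * ‖x‖ ^ 2 + a * ‖x‖) := by
  rw [lyapunov, add_sub_cancel_left, abs_mul, abs_of_nonneg hβ]
  refine mul_le_mul_of_nonneg_left ((abs_add_le _ _).trans (add_le_add ?_ ?_)) hβ
  · refine (abs_real_inner_le_norm _ _).trans ?_
    have := (M z).le_of_opNorm_le (hM z) x
    nlinarith [norm_nonneg x]
  · exact (abs_real_inner_le_norm _ _).trans
      (mul_le_mul_of_nonneg_right (hm z) (norm_nonneg _))

omit [MeasurableSpace Z] in
theorem lyapunov_saUpdate_le (ha : 1 ≤ a) (hH : ∀ z z', ‖H z z'‖ ≤ a)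
    (hb : ∀ z z', ‖b z z'‖ ≤ a) (hM : ∀ z, ‖M z‖ ≤ a) (hm : ∀ z, ‖m z‖ ≤ a)
    (hβ : 0 ≤ β) (hβ1 : β ≤ 1) (x : E) (z z' : Z) :
    lyapunov M m β (saUpdate H b β x z z') z' ≤
      ‖x‖ ^ 2 + 2 * β * (inner ℝ x (H z z' x) + inner ℝ x (b z z')) +
        β * (inner ℝ x (M z' x) + inner ℝ x (m z')) + 9 * a ^ 3 * β ^ 2 * (‖x‖ ^ 2 + 1) := by
  rw [← inner_add_right x (H z z' x)]
  have hu : ‖H z z' x + b z z'‖ ≤ a * (‖x‖ + 1) := by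
    refine (norm_add_le _ _).trans ?_
    have := (H z z').le_of_opNorm_le (hH z z') x
    linarith [hb z z']
  set u := H z z' x + b z z' with hud
  have hy := norm_nonneg x
  have hu0 := norm_nonneg u
  have i1 : inner ℝ u (M z' x) ≤ ‖u‖ * (a * ‖x‖) := (real_inner_le_norm _ _).trans
    (mul_le_mul_of_nonneg_left ((M z').le_of_opNorm_le (hM z') x) hu0)
  have i2 : inner ℝ x (M z' u) ≤ ‖x‖ * (a * ‖u‖) := (real_inner_le_norm _ _).trans
    (mul_le_mul_of_nonneg_left ((M z').le_of_opNorm_le (hM z') u) hy)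
  have i3 : inner ℝ u (M z' u) ≤ ‖u‖ * (a * ‖u‖) := (real_inner_le_norm _ _).trans
    (mul_le_mul_of_nonneg_left ((M z').le_of_opNorm_le (hM z') u) hu0)
  have i4 : inner ℝ (m z') u ≤ a * ‖u‖ := (real_inner_le_norm _ _).trans
    (mul_le_mul_of_nonneg_right (hm z') hu0)
  have ha0 : 0 ≤ a := by linarith
  have hyy : ‖x‖ * 2 ≤ ‖x‖ ^ 2 + 1 := by nlinarith [sq_nonneg (‖x‖ - 1)]
  have hu2 : ‖u‖ ^ 2 ≤ 2 * a ^ 2 * (‖x‖ ^ 2 + 1) := by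
    have h1 : ‖u‖ ^ 2 ≤ (a * (‖x‖ + 1)) ^ 2 := pow_le_pow_left₀ hu0 hu 2
    have h2 := mul_le_mul_of_nonneg_left hyy (sq_nonneg a)
    nlinarith
  have hux : a * (‖u‖ * ‖x‖) * 2 ≤ 3 * a ^ 2 * (‖x‖ ^ 2 + 1) := by
    have h1 : a * (‖u‖ * ‖x‖) ≤ a * (a * (‖x‖ + 1) * ‖x‖) := by gcongr
    have h2 := mul_le_mul_of_nonneg_left hyy (sq_nonneg a)
    nlinarith [sq_nonneg a]
  have hau : a * ‖u‖ ≤ 2 * a ^ 2 * (‖x‖ ^ 2 + 1) := by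
    have h1 := mul_le_mul_of_nonneg_left hu ha0
    have h2 := mul_le_mul_of_nonneg_left hyy (sq_nonneg a)
    nlinarith [sq_nonneg (a * ‖x‖), sq_nonneg a]
  have ha23 : a ^ 2 ≤ a ^ 3 := pow_le_pow_right₀ ha (by norm_num)
  -- All terms of order `β²` and higher. The bounds on the pieces add up to `7 a² + 2 a³`, which is
  -- at most `9 a³` since `1 ≤ a`.
  have hsum : ‖u‖ ^ 2 + (inner ℝ u (M z' x) + inner ℝ x (M z' u) + β * inner ℝ u (M z' u)
      + inner ℝ (m z') u) ≤ 9 * a ^ 3 * (‖x‖ ^ 2 + 1) := by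
    have h3 : β * inner ℝ u (M z' u) ≤ a * ‖u‖ ^ 2 := by
      have hn : 0 ≤ ‖u‖ * (a * ‖u‖) := by positivity
      calc β * inner ℝ u (M z' u) ≤ β * (‖u‖ * (a * ‖u‖)) := by gcongr
        _ ≤ 1 * (‖u‖ * (a * ‖u‖)) := by gcongr
        _ = a * ‖u‖ ^ 2 := by ring
    have h4 := mul_le_mul_of_nonneg_left hu2 ha0
    have h5 := mul_le_mul_of_nonneg_right ha23 (by positivity : 0 ≤ ‖x‖ ^ 2 + 1)
    nlinarith
  have hexp : lyapunov M m β (saUpdate H b β x z z') z' =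
      ‖x‖ ^ 2 + 2 * β * inner ℝ x u + β * (inner ℝ x (M z' x) + inner ℝ x (m z')) +
      β ^ 2 * (‖u‖ ^ 2 + (inner ℝ u (M z' x) + inner ℝ x (M z' u) + β * inner ℝ u (M z' u)
      + inner ℝ (m z') u)) := by
    rw [lyapunov, saUpdate, ← hud, norm_add_sq_real, norm_smul, Real.norm_eq_abs, mul_pow,
      sq_abs, map_add, map_smul, real_inner_comm (m z') x]
    simp only [inner_add_left, inner_add_right, real_inner_smul_left, real_inner_smul_right]
    ring
  rw [hexp]
  have := mul_le_mul_of_nonneg_left hsum (sq_nonneg β)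
  linarith

omit [MeasurableSpace Z] in
-- At a fixed time the iterate is bounded uniformly over all trajectories; the bound may grow with
-- `t`, as it serves only integrability.
theorem exists_norm_saIter_le (ha : 1 ≤ a) (hH : ∀ z z', ‖H z z'‖ ≤ a)
    (hb : ∀ z z', ‖b z z'‖ ≤ a) (β : ℝ) (x₀ : E) (t : ℕ) :
    ∃ B, ∀ z : ℕ → Z, ‖saIter H b β x₀ z t‖ ≤ B := by
  induction t with
  | zero => exact ⟨‖x₀‖, fun z => le_rfl⟩
  | succ t ih =>
    obtain ⟨B, hB⟩ := ih
    refine ⟨B + |β| * (a * B + a), fun z => ?_⟩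
    rw [saIter, saUpdate]
    refine (norm_add_le _ _).trans (add_le_add (hB z) ?_)
    rw [norm_smul, Real.norm_eq_abs]
    refine mul_le_mul_of_nonneg_left ((norm_add_le _ _).trans (add_le_add ?_ (hb _ _)))
      (abs_nonneg _)
    exact ((H _ _).le_of_opNorm_le (hH _ _) _).trans
      (mul_le_mul_of_nonneg_left (hB z) (by linarith))

theorem stronglyMeasurable_clm_apply {X : Type*} [MeasurableSpace X] {T : X → E →L[ℝ] E}
    {x : X → E} (hT : StronglyMeasurable T) (hx : StronglyMeasurable x) :
    StronglyMeasurable fun ω => T ω (x ω) :=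
  (isBoundedBilinearMap_apply (𝕜 := ℝ) (E := E) (F := E)).continuous.comp_stronglyMeasurable
    (hT.prodMk hx)

namespace IsContractiveSA

theorem stronglyMeasurable_saUpdate (h : IsContractiveSA K H b M m Abar a c) (β : ℝ)
    {X : Type*} [MeasurableSpace X] {x : X → E} {z z' : X → Z} (hx : StronglyMeasurable x)
    (hz : Measurable z) (hz' : Measurable z') :
    StronglyMeasurable fun ω => saUpdate H b β (x ω) (z ω) (z' ω) :=
  hx.add (((stronglyMeasurable_clm_apply (h.H_meas.comp_measurable (hz.prodMk hz')) hx).add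
    (h.b_meas.comp_measurable (hz.prodMk hz'))).const_smul β)

theorem stronglyMeasurable_lyapunov (h : IsContractiveSA K H b M m Abar a c) (β : ℝ)
    {X : Type*} [MeasurableSpace X] {x : X → E} {z : X → Z} (hx : StronglyMeasurable x)
    (hz : Measurable z) : StronglyMeasurable fun ω => lyapunov M m β (x ω) (z ω) :=
  (hx.norm.pow 2).add (((hx.inner (𝕜 := ℝ) (stronglyMeasurable_clm_apply
    (h.M_meas.comp_measurable hz) hx)).add
      ((h.m_meas.comp_measurable hz).inner (𝕜 := ℝ) hx)).const_mul β)

theorem abs_lyapunov_le (h : IsContractiveSA K H b M m Abar a c) (hβ : 0 ≤ β) {B : ℝ}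
    {x : E} (hx : ‖x‖ ≤ B) (z : Z) :
    |lyapunov M m β x z| ≤ B ^ 2 + β * (a * B ^ 2 + a * B) := by
  have h1 := abs_lyapunov_sub_sq_le h.M_le h.m_le hβ x z
  have ha : 0 ≤ a := by linarith [h.one_le]
  have h2 : ‖x‖ ^ 2 ≤ B ^ 2 := pow_le_pow_left₀ (norm_nonneg x) hx 2
  have h3 : β * (a * ‖x‖ ^ 2 + a * ‖x‖) ≤ β * (a * B ^ 2 + a * B) := by gcongr
  have h4 := abs_sub_abs_le_abs_sub (lyapunov M m β x z) (‖x‖ ^ 2)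
  rw [abs_of_nonneg (sq_nonneg ‖x‖)] at h4
  linarith

theorem integral_lyapunov_le [CompleteSpace E] [IsMarkovKernel K]
    (h : IsContractiveSA K H b M m Abar a c) (hβ : 0 ≤ β) (hβ1 : β ≤ 1)
    (hβa : 4 * a * β ≤ 1) (hβc : 9 * a ^ 3 * β ≤ c) (x : E) (z : Z) :
    ∫ z', lyapunov M m β (saUpdate H b β x z z') z' ∂K z ≤
      (1 - c / 2 * β) * lyapunov M m β x z + (a * c / 2 + 9 * a ^ 3) * β ^ 2 := by
  have hz : Measurable (Prod.mk z : Z → Z × Z) := measurable_prodMk_left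
  have hHz : StronglyMeasurable fun z' => H z z' := h.H_meas.comp_measurable hz
  have hbz : StronglyMeasurable fun z' => b z z' := h.b_meas.comp_measurable hz
  have iH := integrable_of_norm_le hHz (h.H_le z) (K z)
  have ib := integrable_of_norm_le hbz (h.b_le z) (K z)
  have iM := integrable_of_norm_le h.M_meas h.M_le (K z)
  have im := integrable_of_norm_le h.m_meas h.m_le (K z)
  have iHx : Integrable (fun z' => H z z' x) (K z) := iH.apply_continuousLinearMap x
  have iMx : Integrable (fun z' => M z' x) (K z) := iM.apply_continuousLinearMap x
  have jH := iHx.const_inner (𝕜 := ℝ) x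
  have jb := ib.const_inner (𝕜 := ℝ) x
  have jM := iMx.const_inner (𝕜 := ℝ) x
  have jm := im.const_inner (𝕜 := ℝ) x
  have i1 := (jH.add jb).const_mul (2 * β)
  have i2 := (jM.add jm).const_mul β
  have i3 := ((integrable_const (μ := K z) (‖x‖ ^ 2)).add i1).add i2
  have hle : ∫ z', lyapunov M m β (saUpdate H b β x z z') z' ∂K z ≤
      ∫ z', (‖x‖ ^ 2 + 2 * β * (inner ℝ x (H z z' x) + inner ℝ x (b z z')) +
        β * (inner ℝ x (M z' x) + inner ℝ x (m z')) + 9 * a ^ 3 * β ^ 2 * (‖x‖ ^ 2 + 1))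
          ∂K z := by
    refine integral_mono (integrable_of_norm_le (C := (‖x‖ + |β| * (a * ‖x‖ + a)) ^ 2 +
      β * (a * (‖x‖ + |β| * (a * ‖x‖ + a)) ^ 2 + a * (‖x‖ + |β| * (a * ‖x‖ + a))))
      (h.stronglyMeasurable_lyapunov β (h.stronglyMeasurable_saUpdate β stronglyMeasurable_const
        measurable_const measurable_id) measurable_id) (fun z' => ?_) _)
      (i3.add (integrable_const _)) fun z' => lyapunov_saUpdate_le h.one_le h.H_le h.b_le h.M_le h.m_le hβ hβ1 x z z'
    refine h.abs_lyapunov_le hβ ?_ z'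
    rw [saUpdate]
    refine (norm_add_le _ _).trans (add_le_add le_rfl ?_)
    rw [norm_smul, Real.norm_eq_abs]
    exact mul_le_mul_of_nonneg_left ((norm_add_le _ _).trans (add_le_add
      ((H _ _).le_of_opNorm_le (h.H_le _ _) _) (h.b_le _ _))) (abs_nonneg _)
  have heq : ∫ z', (‖x‖ ^ 2 + 2 * β * (inner ℝ x (H z z' x) + inner ℝ x (b z z')) +
        β * (inner ℝ x (M z' x) + inner ℝ x (m z')) + 9 * a ^ 3 * β ^ 2 * (‖x‖ ^ 2 + 1)) ∂K z =
      ‖x‖ ^ 2 + 2 * β * (inner ℝ x ((∫ y, H z y ∂K z) x) + inner ℝ x (∫ y, b z y ∂K z)) +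
        β * (inner ℝ x ((∫ y, M y ∂K z) x) + inner ℝ x (∫ y, m y ∂K z)) +
        9 * a ^ 3 * β ^ 2 * (‖x‖ ^ 2 + 1) := by
    have e1 := integral_add' i3 (integrable_const (μ := K z) (9 * a ^ 3 * β ^ 2 * (‖x‖ ^ 2 + 1)))
    refine e1.trans ?_
    rw [integral_add' ((integrable_const _).add i1) i2, integral_add' (integrable_const _) i1,
      integral_const_mul, integral_const_mul, integral_add' jH jb, integral_add' jM jm,
      integral_inner iHx, integral_inner ib,
      integral_inner iMx, integral_inner im, ContinuousLinearMap.integral_apply iH,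
      ContinuousLinearMap.integral_apply iM]
    simp
  rw [heq] at hle
  -- The Poisson equations replace `2 β ⟨x, E[H] x⟩` by `2 β ⟨x, Abar x⟩` and remove the mean of `b`
  -- altogether. The factor `2` in them matches the cross term of the expanded square.
  have eM : ∫ y, M y ∂K z = M z - (2 : ℝ) • (∫ y, H z y ∂K z - Abar) := by
    rw [← h.M_eq z]; abel
  have em : ∫ y, m y ∂K z = m z - (2 : ℝ) • ∫ y, b z y ∂K z := by
    rw [← h.m_eq z]; abel
  rw [eM, em] at hle
  simp only [sub_apply, smul_apply, inner_sub_right,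
    real_inner_smul_right] at hle
  have hl : lyapunov M m β x z = ‖x‖ ^ 2 + β * (inner ℝ x (M z x) + inner ℝ x (m z)) := by
    rw [lyapunov, real_inner_comm (m z) x]
  have hub := (abs_le.1 (abs_lyapunov_sub_sq_le h.M_le h.m_le hβ x z)).2
  have hd := mul_le_mul_of_nonneg_left (h.drift x) hβ
  have ha := h.one_le
  have hc := h.c_pos
  have hy2 := sq_nonneg ‖x‖
  -- Drift gives `-2 c β ‖x‖²`, and the second-order terms consume half of it. This bound turns the
  -- remaining `-c β ‖x‖²` into `-(c / 2) β` times the Lyapunov function, at the cost of `a c / 2 *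
  -- β²`.
  have h1 : lyapunov M m β x z ≤ 2 * ‖x‖ ^ 2 + a * β := by
    have h2 : ‖x‖ ≤ ‖x‖ ^ 2 + 1 := by nlinarith [sq_nonneg (‖x‖ - 1)]
    have h3 : β * (a * ‖x‖ ^ 2 + a * ‖x‖) ≤ β * (a * ‖x‖ ^ 2 + a * (‖x‖ ^ 2 + 1)) := by gcongr
    have h4 := mul_le_mul_of_nonneg_right hβa hy2
    linarith
  have h5 : 9 * a ^ 3 * β ^ 2 * ‖x‖ ^ 2 ≤ c * β * ‖x‖ ^ 2 := by
    have := mul_le_mul_of_nonneg_right hβc (mul_nonneg hβ hy2)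
    linarith
  have h6 := mul_le_mul_of_nonneg_left h1 (by positivity : 0 ≤ c / 2 * β)
  linarith

/-- Writing the iterate as a measurable function of the history lets the Markov property, a
statement on the joint law of history and next point, be applied. -/
theorem exists_saIter_eq (h : IsContractiveSA K H b M m Abar a c) (β : ℝ) (x₀ : E) (t : ℕ) :
    ∃ X : (Fin (t + 1) → Z) → E, StronglyMeasurable X ∧
      ∀ z : ℕ → Z, saIter H b β x₀ z t = X fun k => z k := by
  induction t with
  | zero => exact ⟨fun _ => x₀, stronglyMeasurable_const, fun z => rfl⟩
  | succ t ih =>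
    obtain ⟨X, hX, hXe⟩ := ih
    refine ⟨fun y => saUpdate H b β (X fun k => y k.castSucc) (y (Fin.last t).castSucc)
      (y (Fin.last (t + 1))), ?_, fun z => ?_⟩
    · exact h.stronglyMeasurable_saUpdate β (hX.comp_measurable
        (measurable_pi_lambda _ fun k => measurable_pi_apply _))
        (measurable_pi_apply _) (measurable_pi_apply _)
    · rw [saIter, hXe z]
      simp

/-- The Lyapunov function decays along a trajectory of the Markov chain `K`. -/
theorem integral_lyapunov_succ_le [CompleteSpace E] [IsMarkovKernel K]
    (h : IsContractiveSA K H b M m Abar a c) (hβ : 0 ≤ β) (hβ1 : β ≤ 1)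
    (hβa : 4 * a * β ≤ 1) (hβc : 9 * a ^ 3 * β ≤ c) (x₀ : E)
    {Ω : Type*} [MeasurableSpace Ω] (μ : Measure Ω) [IsProbabilityMeasure μ] {z : ℕ → Ω → Z}
    (hz : ∀ t, Measurable (z t)) (t : ℕ)
    (hstep : μ.map (fun ω => ((fun k : Fin (t + 1) => z k ω), z (t + 1) ω)) =
      (μ.map fun ω => fun k : Fin (t + 1) => z k ω) ⊗ₘ
        K.comap (fun h : Fin (t + 1) → Z => h (Fin.last t)) (measurable_pi_apply _)) :
    ∫ ω, lyapunov M m β (saIter H b β x₀ (fun k => z k ω) (t + 1)) (z (t + 1) ω) ∂μ ≤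
      (1 - c / 2 * β) * ∫ ω, lyapunov M m β (saIter H b β x₀ (fun k => z k ω) t) (z t ω) ∂μ
        + (a * c / 2 + 9 * a ^ 3) * β ^ 2 := by
  obtain ⟨X, hX, hXe⟩ := h.exists_saIter_eq β x₀ t
  obtain ⟨B, hB⟩ := exists_norm_saIter_le h.one_le h.H_le h.b_le β x₀ t
  obtain ⟨B', hB'⟩ := exists_norm_saIter_le h.one_le h.H_le h.b_le β x₀ (t + 1)
  have hXB : ∀ y, ‖X y‖ ≤ B := fun y => by
    -- The bound concerns infinite sequences, so the finite history is extended periodically; only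
    -- indices up to `t` matter.
    have := hB fun k => y (Fin.ofNat (t + 1) k)
    rwa [hXe, show (fun k : Fin (t + 1) => y (Fin.ofNat (t + 1) k)) = y by ext k; simp] at this
  have hpast : Measurable fun ω => fun k : Fin (t + 1) => z k ω :=
    measurable_pi_lambda _ fun k => hz k
  have hlast : Measurable fun y : Fin (t + 1) → Z => y (Fin.last t) := measurable_pi_apply _
  let F : (Fin (t + 1) → Z) × Z → ℝ := fun p =>
    lyapunov M m β (saUpdate H b β (X p.1) (p.1 (Fin.last t)) p.2) p.2
  let V : (Fin (t + 1) → Z) → ℝ := fun y => lyapunov M m β (X y) (y (Fin.last t))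
  have hF : StronglyMeasurable F := h.stronglyMeasurable_lyapunov β
    (h.stronglyMeasurable_saUpdate β (hX.comp_measurable measurable_fst)
      (hlast.comp measurable_fst) measurable_snd) measurable_snd
  have hV : StronglyMeasurable V := h.stronglyMeasurable_lyapunov β hX hlast
  have hFB : ∀ p, ‖F p‖ ≤ B' ^ 2 + β * (a * B' ^ 2 + a * B') := fun p => by
    refine h.abs_lyapunov_le hβ ?_ _
    have := hB' fun k => if hk : k < t + 1 then p.1 ⟨k, hk⟩ else p.2
    rw [saIter, hXe] at this
    have hlt : ∀ k : Fin (t + 1), (k : ℕ) < t + 1 := fun k => k.isLt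
    simpa only [hlt, dif_pos, Nat.lt_succ_self, lt_irrefl, dif_neg, not_false_eq_true, Fin.eta,
      Fin.last] using this
  have hVB : ∀ y, ‖V y‖ ≤ B ^ 2 + β * (a * B ^ 2 + a * B) := fun y =>
    h.abs_lyapunov_le hβ (hXB y) _
  have e1 : ∀ ω, lyapunov M m β (saIter H b β x₀ (fun k => z k ω) (t + 1)) (z (t + 1) ω) =
      F (fun k => z k ω, z (t + 1) ω) := fun ω => by
    rw [saIter, hXe]; simp [F]
  have e2 : ∀ ω, lyapunov M m β (saIter H b β x₀ (fun k => z k ω) t) (z t ω) =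
      V (fun k => z k ω) := fun ω => by
    rw [hXe]; simp [V]
  have hprob : IsProbabilityMeasure (μ.map fun ω => fun k : Fin (t + 1) => z k ω) :=
    Measure.isProbabilityMeasure_map hpast.aemeasurable
  simp_rw [e1, e2]
  rw [← integral_map (hpast.prodMk (hz (t + 1))).aemeasurable hF.aestronglyMeasurable, hstep,
    Measure.integral_compProd (integrable_of_norm_le hF hFB _),
    ← integral_map hpast.aemeasurable hV.aestronglyMeasurable]
  have iV := integrable_of_norm_le hV hVB (μ.map fun ω => fun k : Fin (t + 1) => z k ω)
  have iF : Integrable (fun y => ∫ z', F (y, z')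
      ∂K.comap (fun h : Fin (t + 1) → Z => h (Fin.last t)) hlast y)
      (μ.map fun ω => fun k : Fin (t + 1) => z k ω) :=
    integrable_of_norm_le (C := B' ^ 2 + β * (a * B' ^ 2 + a * B'))
      hF.integral_kernel_prod_right' (fun y => by
        simpa using norm_integral_le_of_norm_le_const
          (μ := K.comap (fun h : Fin (t + 1) → Z => h (Fin.last t)) hlast y)
          (ae_of_all _ fun z' => hFB (y, z'))) _
  refine (integral_mono iF ((iV.const_mul (1 - c / 2 * β)).add
    (integrable_const ((a * c / 2 + 9 * a ^ 3) * β ^ 2))) fun y => ?_).trans_eq ?_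
  · exact h.integral_lyapunov_le hβ hβ1 hβa hβc (X y) (y (Fin.last t))
  · rw [integral_add' (iV.const_mul _) (integrable_const _), integral_const_mul]
    simp

theorem stronglyMeasurable_saIter (h : IsContractiveSA K H b M m Abar a c) (β : ℝ) (x₀ : E)
    {Ω : Type*} [MeasurableSpace Ω] {z : ℕ → Ω → Z} (hz : ∀ t, Measurable (z t)) (t : ℕ) :
    StronglyMeasurable fun ω => saIter H b β x₀ (fun k => z k ω) t := by
  induction t with
  | zero => exact stronglyMeasurable_const
  | succ t ih => exact h.stronglyMeasurable_saUpdate β ih (hz t) (hz (t + 1))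

theorem integrable_saIter_sq (h : IsContractiveSA K H b M m Abar a c) (β : ℝ) (x₀ : E)
    {Ω : Type*} [MeasurableSpace Ω] (μ : Measure Ω) [IsFiniteMeasure μ] {z : ℕ → Ω → Z}
    (hz : ∀ t, Measurable (z t)) (t : ℕ) :
    Integrable (fun ω => ‖saIter H b β x₀ (fun k => z k ω) t‖ ^ 2) μ := by
  obtain ⟨B, hB⟩ := exists_norm_saIter_le h.one_le h.H_le h.b_le β x₀ t
  refine integrable_of_norm_le ((h.stronglyMeasurable_saIter β x₀ hz t).norm.pow 2)
    (C := B ^ 2) (fun ω => ?_) μ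
  rw [Pi.pow_apply, norm_pow, norm_norm]
  exact pow_le_pow_left₀ (norm_nonneg _) (hB _) 2

/-- The mean squared norm of the iterates decays geometrically up to an error of order `β`. -/
theorem integral_saIter_sq_le [CompleteSpace E] [IsMarkovKernel K]
    (h : IsContractiveSA K H b M m Abar a c) (hβ : 0 ≤ β) (hβ1 : β ≤ 1)
    (hβa : 4 * a * β ≤ 1) (hβc : 9 * a ^ 3 * β ≤ c) (hcβ : c / 2 * β ≤ 1) (x₀ : E)
    {Ω : Type*} [MeasurableSpace Ω] (μ : Measure Ω) [IsProbabilityMeasure μ] {z : ℕ → Ω → Z}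
    (hz : ∀ t, Measurable (z t))
    (hstep : ∀ t : ℕ, μ.map (fun ω => ((fun k : Fin (t + 1) => z k ω), z (t + 1) ω)) =
      (μ.map fun ω => fun k : Fin (t + 1) => z k ω) ⊗ₘ
        K.comap (fun h : Fin (t + 1) → Z => h (Fin.last t)) (measurable_pi_apply _)) (t : ℕ) :
    ∫ ω, ‖saIter H b β x₀ (fun k => z k ω) t‖ ^ 2 ∂μ ≤
      2 * (2 * ‖x₀‖ ^ 2 + a) * (1 - c / 2 * β) ^ t
        + (2 * (a + 18 * a ^ 3 / c) + 2 * a) * β := by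
  have ha := h.one_le
  have hc := h.c_pos
  have ilyap : ∀ t, Integrable
      (fun ω => lyapunov M m β (saIter H b β x₀ (fun k => z k ω) t) (z t ω)) μ := by
    intro t
    obtain ⟨B, hB⟩ := exists_norm_saIter_le h.one_le h.H_le h.b_le β x₀ t
    exact integrable_of_norm_le (h.stronglyMeasurable_lyapunov β
      (h.stronglyMeasurable_saIter β x₀ hz t) (hz t))
      (fun ω => h.abs_lyapunov_le hβ (hB _) _) μ
  have hrec : ∫ ω, lyapunov M m β (saIter H b β x₀ (fun k => z k ω) t) (z t ω) ∂μ ≤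
      (2 * ‖x₀‖ ^ 2 + a) * (1 - c / 2 * β) ^ t + (a + 18 * a ^ 3 / c) * β := by
    induction t with
    | zero =>
      have h1 : ∀ ω, lyapunov M m β (saIter H b β x₀ (fun k => z k ω) 0) (z 0 ω) ≤
          2 * ‖x₀‖ ^ 2 + a := fun ω => by
        have hub := (abs_le.1 (abs_lyapunov_sub_sq_le h.M_le h.m_le hβ x₀ (z 0 ω))).2
        have h2 : ‖x₀‖ ≤ ‖x₀‖ ^ 2 + 1 := by nlinarith [sq_nonneg (‖x₀‖ - 1)]
        have h3 : β * (a * ‖x₀‖ ^ 2 + a * ‖x₀‖) ≤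
          β * (a * ‖x₀‖ ^ 2 + a * (‖x₀‖ ^ 2 + 1)) := by gcongr
        have h4 := mul_le_mul_of_nonneg_right hβa (sq_nonneg ‖x₀‖)
        have h5 := mul_le_mul_of_nonneg_right hβ1 (by linarith : 0 ≤ a)
        rw [saIter]
        linarith [sq_nonneg ‖x₀‖]
      have h6 := integral_mono (ilyap 0) (integrable_const _) h1
      simp only [integral_const, probReal_univ, one_smul] at h6
      have h7 : 0 ≤ (a + 18 * a ^ 3 / c) * β := by positivity
      simp only [pow_zero, mul_one]
      linarith
    | succ t ih =>
      refine (h.integral_lyapunov_succ_le hβ hβ1 hβa hβc x₀ μ hz t (hstep t)).trans ?_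
      have h1 := mul_le_mul_of_nonneg_left ih (by linarith : 0 ≤ 1 - c / 2 * β)
      -- The level `(a + 18 * a ^ 3 / c) * β` is the fixed point of the recursion: the `β²` error
      -- divided by `c / 2 * β`.
      have h2 : (a * c / 2 + 9 * a ^ 3) * β ^ 2 = c / 2 * β * ((a + 18 * a ^ 3 / c) * β) := by
        field_simp
        ring
      rw [h2, pow_succ]
      refine (add_le_add h1 le_rfl).trans (le_of_eq ?_)
      ring
  -- For `4 a β ≤ 1` the correction is at most a fixed fraction of `‖x‖²` plus `a β`, so the
  -- Lyapunov function controls the squared norm.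
  have hlow : ∀ ω, ‖saIter H b β x₀ (fun k => z k ω) t‖ ^ 2 ≤
      2 * lyapunov M m β (saIter H b β x₀ (fun k => z k ω) t) (z t ω) + 2 * a * β := fun ω => by
    set x := saIter H b β x₀ (fun k => z k ω) t
    have hub := (abs_le.1 (abs_lyapunov_sub_sq_le h.M_le h.m_le hβ x (z t ω))).1
    have h2' : ‖x‖ ≤ 1 + ‖x‖ ^ 2 / 4 := by nlinarith [sq_nonneg (‖x‖ - 2)]
    have h4 := mul_le_mul_of_nonneg_right hβa (sq_nonneg ‖x‖)
    have h3 : β * a * ‖x‖ ≤ β * a * (1 + ‖x‖ ^ 2 / 4) := by gcongr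
    linarith [sq_nonneg ‖x‖]
  have hfin := integral_mono (h.integrable_saIter_sq β x₀ μ hz t)
    (((ilyap t).const_mul 2).add (integrable_const _)) hlow
  rw [integral_add' ((ilyap t).const_mul 2) (integrable_const _), integral_const_mul] at hfin
  simp only [integral_const, probReal_univ, one_smul] at hfin
  linarith

end IsContractiveSA

end StochasticApproximation


/-! ### Convergence of the reward consensus -/

section Consensus

variable {N : ℕ} {Gr : SimpleGraph (Fin N)} {L : Matrix (Fin N) (Fin N) ℝ} {ν : ℝ}

theorem consensusRound_eq_mulVec (hL : IsConsensusMatrix Gr L ν) (x : Fin N → ℝ) :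
    consensusRound Gr L x = L.mulVec x := by
  funext i
  rw [consensusRound, Finset.sum_filter, Matrix.mulVec, dotProduct]
  refine Finset.sum_congr rfl fun j _ => ?_
  split_ifs with h
  · rfl
  · push Not at h
    rw [hL.nonedge i j (Ne.symm h.1) h.2, zero_mul]

theorem consensus_eq_mulVec (hL : IsConsensusMatrix Gr L ν) (G : ℕ) (x : Fin N → ℝ) :
    consensus Gr L G x = (L ^ G).mulVec x := by
  induction G with
  | zero => simp [consensus]
  | succ G ih =>
    rw [consensus, Function.iterate_succ_apply', ← consensus, ih, consensusRound_eq_mulVec hL,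
      Matrix.mulVec_mulVec, pow_succ']

/-- The entry of the power dominates the product of weights along one walk; a walk that is too short
is padded with self-loops, whose weights are also at least `ν`. -/
theorem IsConsensusMatrix.pow_apply_ge (hL : IsConsensusMatrix Gr L ν) {n : ℕ} {i j : Fin N}
    (p : Gr.Walk i j) (hp : p.length ≤ n) : ν ^ n ≤ (L ^ n) i j := by
  have hnn : ∀ n i j, 0 ≤ (L ^ n) i j := fun n =>
    (mem_doublyStochastic.1 (pow_mem hL.doublyStochastic n)).1
  have hstep : ∀ (n : ℕ) (i k j : Fin N), ν ≤ L i k → ν ^ n ≤ (L ^ n) k j →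
      ν ^ (n + 1) ≤ (L ^ (n + 1)) i j := by
    intro n i k j h1 h2
    rw [pow_succ', pow_succ', Matrix.mul_apply]
    have h3 : L i k * (L ^ n) k j ≤ ∑ l, L i l * (L ^ n) l j :=
      Finset.single_le_sum (f := fun l => L i l * (L ^ n) l j)
        (fun l _ => mul_nonneg (by simpa using hnn 1 i l) (hnn n l j)) (Finset.mem_univ k)
    exact (mul_le_mul h1 h2 (pow_nonneg hL.pos.le n) (hL.pos.le.trans h1)).trans h3
  induction n generalizing i j with
  | zero =>
    obtain rfl := SimpleGraph.Walk.eq_of_length_eq_zero (Nat.le_zero.1 hp)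
    simp
  | succ n ih =>
    cases p with
    | nil => exact hstep n i i i (hL.diag i) (ih .nil (by simp))
    | cons h q => exact hstep n i _ j (hL.edge _ _ h) (ih q (by simpa using hp))

theorem IsConsensusMatrix.pow_pred_apply_ge (hG : Gr.Connected) (hL : IsConsensusMatrix Gr L ν)
    (i j : Fin N) : ν ^ (N - 1) ≤ (L ^ (N - 1)) i j := by
  classical
  obtain ⟨p⟩ := hG.preconnected i j
  have h := (p.toPath.2).length_lt
  rw [Fintype.card_fin] at h
  exact hL.pow_apply_ge (p.toPath : Gr.Walk i j) (by omega)

/-- All values of `x` lie in an interval of length `w`. -/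
def OscLE (x : Fin N → ℝ) (w : ℝ) : Prop := ∀ i j, x i - x j ≤ w

/-- Doeblin's argument: the part `ε` of every entry contributes the same amount to all rows, so only
the remaining row mass `1 - N * ε` can separate two coordinates. -/
theorem OscLE.mulVec {B : Matrix (Fin N) (Fin N) ℝ} (hB : B ∈ doublyStochastic ℝ (Fin N))
    {ε : ℝ} (hε : ∀ i j, ε ≤ B i j) {x : Fin N → ℝ} {w : ℝ} (hx : OscLE x w) :
    OscLE (B.mulVec x) ((1 - N * ε) * w) := by
  intro i j
  have hrow : ∀ i, ∑ k, (B i k - ε) = 1 - N * ε := by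
    intro i
    rw [Finset.sum_sub_distrib, (mem_doublyStochastic_iff_sum.1 hB).2.1 i]
    simp
  have : Nonempty (Fin N) := ⟨i⟩
  obtain ⟨p, -, hp⟩ := Finset.exists_max_image Finset.univ x Finset.univ_nonempty
  obtain ⟨q, -, hq⟩ := Finset.exists_min_image Finset.univ x Finset.univ_nonempty
  have h1 : B.mulVec x i ≤ ε * ∑ k, x k + (1 - N * ε) * x p := by
    rw [← hrow i, Finset.mul_sum, Finset.sum_mul, ← Finset.sum_add_distrib, Matrix.mulVec,
      dotProduct]
    refine Finset.sum_le_sum fun k _ => ?_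
    have := mul_le_mul_of_nonneg_left (hp k (Finset.mem_univ k)) (sub_nonneg.2 (hε i k))
    linarith
  have h2 : ε * ∑ k, x k + (1 - N * ε) * x q ≤ B.mulVec x j := by
    rw [← hrow j, Finset.mul_sum, Finset.sum_mul, ← Finset.sum_add_distrib, Matrix.mulVec,
      dotProduct]
    refine Finset.sum_le_sum fun k _ => ?_
    have := mul_le_mul_of_nonneg_left (hq k (Finset.mem_univ k)) (sub_nonneg.2 (hε j k))
    linarith
  have h3 : 0 ≤ 1 - N * ε := by
    rw [← hrow i]
    exact Finset.sum_nonneg fun k _ => sub_nonneg.2 (hε i k)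
  have h4 := mul_le_mul_of_nonneg_left (hx p q) h3
  linarith

/-- Some row contains a diagonal entry and a neighbour's entry, both at least `ν`, and sums to one.
-/
theorem IsConsensusMatrix.le_half (hN : 2 ≤ N) (hG : Gr.Connected)
    (hL : IsConsensusMatrix Gr L ν) : ν ≤ 1 / 2 := by
  have : Nontrivial (Fin N) := Fin.nontrivial_iff_two_le.2 hN
  let i : Fin N := ⟨0, by omega⟩
  obtain ⟨j, hj⟩ := hG.preconnected.exists_adj_of_nontrivial i
  have hds := mem_doublyStochastic_iff_sum.1 hL.doublyStochastic
  have h := Finset.sum_le_sum_of_subset_of_nonneg (Finset.subset_univ {i, j})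
    (fun k _ _ => hds.1 i k)
  rw [Finset.sum_pair hj.ne, hds.2.1 i] at h
  linarith [hL.diag i, hL.edge i j hj]

/-- A block of `N - 1` rounds has all entries at least `ν ^ (N - 1)`, hence contracts by `1 - N * ν
^ (N - 1)`. By Bernoulli's inequality this is at most `(1 - ν ^ (N - 1)) ^ (N - 1)`, one factor for
each round of the block. The leftover `r` rounds do not expand. -/
theorem IsConsensusMatrix.oscLE_pow (hG : Gr.Connected) (hL : IsConsensusMatrix Gr L ν)
    (hν : ν ^ (N - 1) ≤ 1) {x : Fin N → ℝ} {w : ℝ} (hw : 0 ≤ w) (hx : OscLE x w) (q r : ℕ) :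
    OscLE ((L ^ ((N - 1) * q + r)).mulVec x) ((1 - ν ^ (N - 1)) ^ ((N - 1) * q) * w) := by
  induction q with
  | zero =>
    have h := hx.mulVec (pow_mem hL.doublyStochastic r) (ε := 0)
      (mem_doublyStochastic.1 (pow_mem hL.doublyStochastic r)).1
    simpa using h
  | succ q ih =>
    have h := ih.mulVec (pow_mem hL.doublyStochastic (N - 1)) (hL.pow_pred_apply_ge hG)
    rw [Matrix.mulVec_mulVec, ← pow_add] at h
    rw [show (N - 1) * (q + 1) + r = N - 1 + ((N - 1) * q + r) by ring]
    intro i j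
    refine (h i j).trans ?_
    rw [← mul_assoc, show (N - 1) * (q + 1) = (N - 1) + (N - 1) * q by ring, pow_add]
    have hε : 0 ≤ ν ^ (N - 1) := pow_nonneg hL.pos.le _
    have hb : 1 - N * ν ^ (N - 1) ≤ (1 - ν ^ (N - 1)) ^ (N - 1) := by
      have h1 := one_add_mul_le_pow (a := -ν ^ (N - 1)) (by linarith) (N - 1)
      have h2 : ((N - 1 : ℕ) : ℝ) ≤ N := by exact_mod_cast Nat.sub_le N 1
      have h3 := mul_le_mul_of_nonneg_right h2 hε
      rw [← sub_eq_add_neg] at h1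
      linarith
    have h4 : 0 ≤ 1 - ν ^ (N - 1) := by linarith
    gcongr

/-- After `G` rounds, the consensus values are close to the average. -/
theorem IsConsensusMatrix.abs_consensus_sub_le (hN : 2 ≤ N) (hG : Gr.Connected)
    (hL : IsConsensusMatrix Gr L ν) {x : Fin N → ℝ} {r : ℝ} (hr : 0 < r)
    (hx : ∀ i, |x i| ≤ r) (G : ℕ) (i : Fin N) :
    |consensus Gr L G x i - (∑ j, x j) / N| ≤ 4 * r * (1 - ν ^ (N - 1)) ^ G := by
  have hν := hL.le_half hN hG
  have hN0 : (0 : ℝ) < N := by exact_mod_cast (by omega : 0 < N)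
  set ε := ν ^ (N - 1) with hεd
  have hε0 : 0 ≤ ε := pow_nonneg hL.pos.le _
  have hε1 : ε ≤ (1 / 2) ^ (N - 1) := pow_le_pow_left₀ hL.pos.le hν _
  have hεle : ε ≤ 1 / 2 := hε1.trans (by
    simpa using pow_le_pow_of_le_one (by norm_num : (0 : ℝ) ≤ 1 / 2) (by norm_num)
      (by omega : 1 ≤ N - 1))
  have hosc : OscLE x (2 * r) := fun i j => by
    linarith [(abs_le.1 (hx i)).2, (abs_le.1 (hx j)).1]
  have h := hL.oscLE_pow hG (by linarith) (by linarith) hosc (G / (N - 1)) (G % (N - 1))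
  rw [Nat.div_add_mod] at h
  rw [consensus_eq_mulVec hL]
  set y := (L ^ G).mulVec x with hy
  -- Unit column sums preserve the average, so the distance to it is bounded by the oscillation of
  -- `y`.
  have hsum : ∑ j, y j = ∑ j, x j := by
    have hds := mem_doublyStochastic_iff_sum.1 (pow_mem hL.doublyStochastic G)
    simp only [hy, Matrix.mulVec, dotProduct]
    rw [Finset.sum_comm]
    simp_rw [← Finset.sum_mul, hds.2.2, one_mul]
  -- Dropping the incomplete block costs a factor of at most `2`: with fewer than `N - 1` leftover
  -- rounds and `ε ≤ 2 ^ (-(N - 1))`, Bernoulli keeps the lost factor above `1 / 2`.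
  have hpow : (1 - ε) ^ ((N - 1) * (G / (N - 1))) ≤ 2 * (1 - ε) ^ G := by
    have hG' : (N - 1) * (G / (N - 1)) + G % (N - 1) = G := Nat.div_add_mod _ _
    have hmod : G % (N - 1) < N - 1 := Nat.mod_lt _ (by omega)
    have h1 : (1 : ℝ) / 2 ≤ (1 - ε) ^ (G % (N - 1)) := by
      have hb := one_add_mul_le_pow (a := -ε) (by linarith) (G % (N - 1))
      rw [← sub_eq_add_neg] at hb
      have h2 : ((G % (N - 1) : ℕ) : ℝ) * ε ≤ 1 / 2 := by
        obtain ⟨m, hm⟩ : ∃ m, N - 1 = m + 1 := ⟨N - 2, by omega⟩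
        have h3 : G % (N - 1) ≤ 2 ^ m := by
          have := Nat.lt_two_pow_self (n := m)
          omega
        have h4 : ((G % (N - 1) : ℕ) : ℝ) ≤ 2 ^ m := by exact_mod_cast h3
        calc ((G % (N - 1) : ℕ) : ℝ) * ε ≤ 2 ^ m * (1 / 2) ^ (m + 1) := by
              rw [← hm]; gcongr
          _ = 1 / 2 := by rw [pow_succ, ← mul_assoc, ← mul_pow]; norm_num
      linarith
    have h5 : 0 ≤ (1 - ε) ^ ((N - 1) * (G / (N - 1))) := pow_nonneg (by linarith) _
    calc (1 - ε) ^ ((N - 1) * (G / (N - 1)))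
        = 2 * ((1 - ε) ^ ((N - 1) * (G / (N - 1))) * (1 / 2)) := by ring
      _ ≤ 2 * ((1 - ε) ^ ((N - 1) * (G / (N - 1))) * (1 - ε) ^ (G % (N - 1))) := by gcongr
      _ = 2 * (1 - ε) ^ G := by rw [← pow_add, hG']
  have hW : ∀ i j, y i - y j ≤ 4 * r * (1 - ε) ^ G := fun i j => by
    have := mul_le_mul_of_nonneg_right hpow (by linarith : 0 ≤ 2 * r)
    linarith [h i j]
  set W := 4 * r * (1 - ε) ^ G with hWd
  have hup : ∑ j, (y i - y j) ≤ N * W := by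
    refine (Finset.sum_le_sum fun j _ => hW i j).trans (le_of_eq ?_)
    simp
  have hlo : ∑ j, (y j - y i) ≤ N * W := by
    refine (Finset.sum_le_sum fun j _ => hW j i).trans (le_of_eq ?_)
    simp
  rw [Finset.sum_sub_distrib, hsum] at hup hlo
  simp only [Finset.sum_const, Finset.card_univ, Fintype.card_fin, nsmul_eq_mul] at hup hlo
  rw [abs_le]
  constructor
  · rw [le_sub_iff_add_le, ← le_sub_iff_add_le', div_le_iff₀ hN0]
    linarith
  · rw [sub_le_iff_le_add, ← sub_le_iff_le_add', le_div_iff₀ hN0]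
    linarith

end Consensus


/-! ### The mean dynamics of linear TD -/

section TemporalDifference

variable {S A E : Type*} [NormedAddCommGroup E] [InnerProductSpace ℝ E]

/-- The TD increment is affine in the parameter; this is its linear part. -/
def tdLinear (f : S → E) (γ : ℝ) (z z' : S × A) :
    E →L[ℝ] E :=
  (innerSL ℝ (γ • f z'.1 - f z.1)).smulRight (f z.1)

/-- The TD increment, before multiplication by the step size, for the reward `r` at `w`. -/
def tdIncrement (f : S → E) (γ : ℝ) (r : S × A → S × A → ℝ)
    (w : E) (z z' : S × A) : E :=
  (r z z' + γ * inner ℝ (f z'.1) w - inner ℝ (f z.1) w) • f z.1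

variable {f : S → E} {γ : ℝ}

theorem tdLinear_apply (x : E) (z z' : S × A) :
    tdLinear f γ z z' x = (γ * inner ℝ (f z'.1) x - inner ℝ (f z.1) x) • f z.1 := by
  rw [tdLinear, ContinuousLinearMap.smulRight_apply, innerSL_apply_apply, inner_sub_left, real_inner_smul_left]

theorem tdIncrement_eq (r : S × A → S × A → ℝ) (w : E) (z z' : S × A) :
    tdIncrement f γ r w z z' = r z z' • f z.1 + tdLinear f γ z z' w := by
  rw [tdIncrement, tdLinear_apply, ← add_smul, add_sub_assoc]

theorem norm_tdLinear_le (hf : ∀ s, ‖f s‖ ≤ 1) (hγ0 : 0 ≤ γ) (z z' : S × A) :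
    ‖tdLinear f γ z z'‖ ≤ 1 + γ := by
  rw [tdLinear, ContinuousLinearMap.norm_smulRight_apply, innerSL_apply_norm, mul_comm]
  have h1 : ‖γ • f z'.1 - f z.1‖ ≤ 1 + γ := by
    refine (norm_sub_le _ _).trans ?_
    rw [norm_smul, Real.norm_of_nonneg hγ0]
    nlinarith [hf z'.1, hf z.1]
  calc ‖f z.1‖ * ‖γ • f z'.1 - f z.1‖ ≤ 1 * (1 + γ) := by
        gcongr
        exact hf _
    _ = 1 + γ := one_mul _

theorem norm_tdIncrement_le (hf : ∀ s, ‖f s‖ ≤ 1) (hγ0 : 0 ≤ γ) {r : S × A → S × A → ℝ}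
    {R : ℝ} (hr : ∀ z z', |r z z'| ≤ R) (w : E) (z z' : S × A) :
    ‖tdIncrement f γ r w z z'‖ ≤ R + (1 + γ) * ‖w‖ := by
  rw [tdIncrement_eq]
  refine (norm_add_le _ _).trans (add_le_add ?_
    ((tdLinear f γ z z').le_of_opNorm_le (norm_tdLinear_le hf hγ0 z z') w))
  rw [norm_smul, Real.norm_eq_abs]
  have := mul_le_mul (hr z z') (hf z.1) (norm_nonneg _) ((abs_nonneg _).trans (hr z z'))
  linarith

variable [MeasurableSpace S] [MeasurableSpace A] [FiniteDimensional ℝ E] [MeasurableSpace E]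
  [BorelSpace E]

theorem stronglyMeasurable_tdLinear (hf : Measurable f) :
    StronglyMeasurable (Function.uncurry (tdLinear (A := A) f γ)) := by
  have h1 : Measurable fun p : (S × A) × (S × A) => f p.1.1 :=
    hf.comp (measurable_fst.comp measurable_fst)
  have h2 : Measurable fun p : (S × A) × (S × A) => γ • f p.2.1 - f p.1.1 :=
    ((hf.comp (measurable_fst.comp measurable_snd)).const_smul γ).sub h1
  exact (ContinuousLinearMap.smulRightL ℝ E E).continuous₂.comp_stronglyMeasurable
    (((innerSL ℝ).continuous.comp_stronglyMeasurable h2.stronglyMeasurable).prodMk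
      h1.stronglyMeasurable)

theorem stronglyMeasurable_tdIncrement (hf : Measurable f) {r : S × A → S × A → ℝ}
    (hr : Measurable (Function.uncurry r)) (w : E) :
    StronglyMeasurable (Function.uncurry (tdIncrement f γ r w)) := by
  have h1 : Measurable fun p : (S × A) × (S × A) => f p.1.1 :=
    hf.comp (measurable_fst.comp measurable_fst)
  have h := (hr.stronglyMeasurable.smul h1.stronglyMeasurable).add
    (stronglyMeasurable_clm_apply (stronglyMeasurable_tdLinear (A := A) (γ := γ) hf)
      (stronglyMeasurable_const (b := w)))
  convert h using 1
  ext1 p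
  exact tdIncrement_eq r w p.1 p.2

omit [MeasurableSpace E] [BorelSpace E] in
-- The quadratic form attains its maximum on the compact unit sphere, where it is negative;
-- homogeneity does the rest.
theorem exists_coercive_of_inner_neg (T : E →L[ℝ] E) (hT : ∀ x, x ≠ 0 → inner ℝ x (T x) < 0) :
    ∃ c, 0 < c ∧ ∀ x, inner ℝ x (T x) ≤ -c * ‖x‖ ^ 2 := by
  rcases subsingleton_or_nontrivial E with hE | hE
  · exact ⟨1, one_pos, fun x => by simp [Subsingleton.elim x 0]⟩
  · obtain ⟨u, hu, hmax⟩ := (isCompact_sphere (0 : E) 1).exists_isMaxOn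
      ((NormedSpace.sphere_nonempty (E := E)).2 zero_le_one)
      (f := fun x => inner ℝ x (T x)) (by fun_prop)
    have hu1 : ‖u‖ = 1 := by simpa using hu
    refine ⟨-inner ℝ u (T u), neg_pos.2 (hT u fun h => by simp [h] at hu1), fun x => ?_⟩
    rcases eq_or_ne x 0 with rfl | hx
    · simp
    have hx' : ‖x‖ ≠ 0 := norm_ne_zero_iff.2 hx
    have h : inner ℝ (‖x‖⁻¹ • x) (T (‖x‖⁻¹ • x)) ≤ inner ℝ u (T u) :=
      hmax (by simp [norm_smul, hx'])
    rw [map_smul, real_inner_smul_left, real_inner_smul_right, ← mul_assoc] at h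
    have h2 := mul_le_mul_of_nonneg_right h (sq_nonneg ‖x‖)
    field_simp at h2
    linarith

variable {P : Kernel (S × A) S} {pol : Kernel S A} [IsMarkovKernel P] [IsMarkovKernel pol]
  {ζ : Measure (S × A)} [IsProbabilityMeasure ζ]

/-- With `V = ⟨f, x⟩`, the form is `E[γ V(s') V(s) - V(s)²]`. Since `2 V(s') V(s) ≤ V(s')² + V(s)²`
and both squares have the same mean in stationarity, it is at most `(γ - 1) E[V²]`. -/
theorem inner_integral_tdLinear_neg (hζ : Kernel.Invariant (saStep P pol) ζ) (hγ0 : 0 ≤ γ)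
    (hγ1 : γ < 1) (hf : Measurable f) (hf1 : ∀ s, ‖f s‖ ≤ 1) {x : E}
    (hx : 0 < ∫ z, (inner ℝ (f z.1) x) ^ 2 ∂ζ) :
    inner ℝ x ((∫ p, tdLinear f γ p.1 p.2 ∂(ζ ⊗ₘ saStep P pol)) x) < 0 := by
  have iT : Integrable (fun p => tdLinear f γ p.1 p.2) (ζ ⊗ₘ saStep P pol) :=
    integrable_of_norm_le (stronglyMeasurable_tdLinear hf)
      (fun p => norm_tdLinear_le hf1 hγ0 p.1 p.2) _
  rw [ContinuousLinearMap.integral_apply iT, ← integral_inner (iT.apply_continuousLinearMap x)]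
  have hg : Measurable fun z : S × A => (inner ℝ (f z.1) x) ^ 2 :=
    ((hf.comp measurable_fst).inner measurable_const).pow_const 2
  have hgb : ∀ z : S × A, ‖(inner ℝ (f z.1) x) ^ 2‖ ≤ ‖x‖ ^ 2 := fun z => by
    rw [norm_pow, Real.norm_eq_abs]
    refine pow_le_pow_left₀ (abs_nonneg _) ((abs_real_inner_le_norm _ _).trans ?_) 2
    nlinarith [hf1 z.1, norm_nonneg x]
  have i1 : Integrable (fun p : (S × A) × (S × A) => (inner ℝ (f p.1.1) x) ^ 2)
      (ζ ⊗ₘ saStep P pol) :=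
    integrable_of_norm_le (hg.comp measurable_fst).stronglyMeasurable (fun p => hgb p.1) _
  have i2 : Integrable (fun p : (S × A) × (S × A) => (inner ℝ (f p.2.1) x) ^ 2)
      (ζ ⊗ₘ saStep P pol) :=
    integrable_of_norm_le (hg.comp measurable_snd).stronglyMeasurable (fun p => hgb p.2) _
  have e1 : ∫ p, (inner ℝ (f p.1.1) x) ^ 2 ∂(ζ ⊗ₘ saStep P pol) =
      ∫ z, (inner ℝ (f z.1) x) ^ 2 ∂ζ := by
    have h := integral_map (μ := ζ ⊗ₘ saStep P pol) measurable_fst.aemeasurable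
      hg.aestronglyMeasurable
    rw [← Measure.fst, Measure.fst_compProd] at h
    exact h.symm
  have e2 : ∫ p, (inner ℝ (f p.2.1) x) ^ 2 ∂(ζ ⊗ₘ saStep P pol) =
      ∫ z, (inner ℝ (f z.1) x) ^ 2 ∂ζ := by
    have h := integral_map (μ := ζ ⊗ₘ saStep P pol) measurable_snd.aemeasurable
      hg.aestronglyMeasurable
    rw [← Measure.snd, Measure.snd_compProd, hζ] at h
    exact h.symm
  have hle := integral_mono ((iT.apply_continuousLinearMap x).const_inner (𝕜 := ℝ) x)
    ((i2.const_mul (γ / 2)).add (i1.const_mul (γ / 2 - 1))) fun p => by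
      change inner ℝ x (tdLinear f γ p.1 p.2 x) ≤ γ / 2 * (inner ℝ (f p.2.1) x) ^ 2 +
        (γ / 2 - 1) * (inner ℝ (f p.1.1) x) ^ 2
      rw [tdLinear_apply, real_inner_smul_right, real_inner_comm (f p.1.1) x]
      nlinarith [mul_nonneg hγ0 (sq_nonneg
        ((inner ℝ (f p.2.1) x : ℝ) - inner ℝ (f p.1.1) x))]
  rw [integral_add' (i2.const_mul _) (i1.const_mul _), integral_const_mul, integral_const_mul,
    e1, e2] at hle
  nlinarith

theorem integral_tdIncrement (hγ0 : 0 ≤ γ) (hf : Measurable f) (hf1 : ∀ s, ‖f s‖ ≤ 1)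
    {r : S × A → S × A → ℝ} (hr : Measurable (Function.uncurry r)) {C : ℝ}
    (hrC : ∀ z z', |r z z'| ≤ C) (w : E) :
    ∫ p, tdIncrement f γ r w p.1 p.2 ∂(ζ ⊗ₘ saStep P pol) =
      ∫ p, tdIncrement f γ r 0 p.1 p.2 ∂(ζ ⊗ₘ saStep P pol) +
        (∫ p, tdLinear f γ p.1 p.2 ∂(ζ ⊗ₘ saStep P pol)) w := by
  have iT : Integrable (fun p => tdLinear f γ p.1 p.2) (ζ ⊗ₘ saStep P pol) :=
    integrable_of_norm_le (stronglyMeasurable_tdLinear hf)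
      (fun p => norm_tdLinear_le hf1 hγ0 p.1 p.2) _
  have i0 : Integrable (fun p => tdIncrement f γ r 0 p.1 p.2) (ζ ⊗ₘ saStep P pol) :=
    integrable_of_norm_le (stronglyMeasurable_tdIncrement hf hr 0)
      (fun p => norm_tdIncrement_le hf1 hγ0 hrC 0 p.1 p.2) _
  rw [ContinuousLinearMap.integral_apply iT,
    ← integral_add i0 (iT.apply_continuousLinearMap w)]
  refine integral_congr_ae (ae_of_all _ fun p => ?_)
  simp only [tdIncrement_eq, map_zero, add_zero]

/-- The equation is affine with negative definite linear part, which is injective and hence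
bijective in finite dimension. -/
theorem existsUnique_integral_tdIncrement_eq_zero (hζ : Kernel.Invariant (saStep P pol) ζ)
    (hγ0 : 0 ≤ γ) (hγ1 : γ < 1) (hf : Measurable f) (hf1 : ∀ s, ‖f s‖ ≤ 1)
    (hindep : ∀ u : E, u ≠ 0 → 0 < ∫ z, (inner ℝ (f z.1) u) ^ 2 ∂ζ)
    {r : S × A → S × A → ℝ} (hr : Measurable (Function.uncurry r)) {C : ℝ}
    (hrC : ∀ z z', |r z z'| ≤ C) :
    ∃! w, ∫ p, tdIncrement f γ r w p.1 p.2 ∂(ζ ⊗ₘ saStep P pol) = 0 := by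
  set T := ∫ p, tdLinear f γ p.1 p.2 ∂(ζ ⊗ₘ saStep P pol) with hT
  have hinj : Function.Injective (T : E →ₗ[ℝ] E) := by
    refine (injective_iff_map_eq_zero _).2 fun x hx => ?_
    by_contra h0
    have := inner_integral_tdLinear_neg hζ hγ0 hγ1 hf hf1 (hindep x h0)
    rw [← hT, show T x = 0 from hx, inner_zero_right] at this
    exact lt_irrefl _ this
  obtain ⟨w, hw⟩ := LinearMap.injective_iff_surjective.1 hinj
    (-∫ p, tdIncrement f γ r 0 p.1 p.2 ∂(ζ ⊗ₘ saStep P pol))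
  have hw' : T w = -∫ p, tdIncrement f γ r 0 p.1 p.2 ∂(ζ ⊗ₘ saStep P pol) := hw
  refine ⟨w, ?_, fun v hv => hinj ?_⟩
  · change ∫ p, tdIncrement f γ r w p.1 p.2 ∂(ζ ⊗ₘ saStep P pol) = 0
    rw [integral_tdIncrement hγ0 hf hf1 hr hrC, ← hT, hw', add_neg_cancel]
  · change ∫ p, tdIncrement f γ r v p.1 p.2 ∂(ζ ⊗ₘ saStep P pol) = 0 at hv
    rw [integral_tdIncrement hγ0 hf hf1 hr hrC, ← hT] at hv
    exact (neg_eq_of_add_eq_zero_right hv).symm.trans hw'.symm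

/-- Averaging over the next point reduces a function of a transition to a function of the current
pair, which is centred under `ζ` after subtracting the stationary mean. -/
theorem exists_poisson_of_pair {F : Type*} [NormedAddCommGroup F] [NormedSpace ℝ F]
    [CompleteSpace F] {κ ρ : ℝ} (hρ0 : 0 < ρ) (hρ1 : ρ < 1)
    (hmix : ∀ (t : ℕ) (s : S), tvDist (saLaw P pol t s) ζ ≤ κ * ρ ^ t)
    {h : S × A → S × A → F} (hh : StronglyMeasurable (Function.uncurry h)) {C : ℝ}
    (hC : ∀ z z', ‖h z z'‖ ≤ C) :
    ∃ g : S × A → F, StronglyMeasurable g ∧ (∃ a, ∀ z, ‖g z‖ ≤ a) ∧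
      ∀ z, g z - ∫ y, g y ∂saStep P pol z = (2 : ℝ) •
        (∫ y, h z y ∂saStep P pol z - ∫ p, h p.1 p.2 ∂(ζ ⊗ₘ saStep P pol)) := by
  have hm : StronglyMeasurable fun z => ∫ y, h z y ∂saStep P pol z :=
    hh.integral_kernel_prod_right
  have hb : ∀ z, ‖∫ y, h z y ∂saStep P pol z‖ ≤ C := fun z => by
    simpa using norm_integral_le_of_norm_le_const (μ := saStep P pol z) (ae_of_all _ (hC z))
  set c := ∫ p, h p.1 p.2 ∂(ζ ⊗ₘ saStep P pol) with hc
  refine exists_poisson P pol ζ hρ0 hρ1 hmix ((hm.sub stronglyMeasurable_const).const_smul 2)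
    (C := 2 * (C + ‖c‖)) (fun z => ?_) ?_
  · rw [norm_smul, Real.norm_ofNat]
    gcongr
    exact (norm_sub_le _ _).trans (add_le_add (hb z) le_rfl)
  · rw [integral_smul, integral_sub (integrable_of_norm_le hm hb ζ) (integrable_const _),
      ← Measure.integral_compProd (f := fun p => h p.1 p.2)
        (integrable_of_norm_le hh (fun p => hC p.1 p.2) _), ← hc]
    simp

/-- Linear TD with a bounded reward, centred at its fixed point, is a contractive linear
stochastic approximation. -/
theorem exists_isContractiveSA {κ ρ : ℝ} (hρ0 : 0 < ρ) (hρ1 : ρ < 1)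
    (hmix : ∀ (t : ℕ) (s : S), tvDist (saLaw P pol t s) ζ ≤ κ * ρ ^ t)
    (hζ : Kernel.Invariant (saStep P pol) ζ)
    (hγ0 : 0 ≤ γ) (hγ1 : γ < 1) (hf : Measurable f) (hf1 : ∀ s, ‖f s‖ ≤ 1)
    (hindep : ∀ u : E, u ≠ 0 → 0 < ∫ z, (inner ℝ (f z.1) u) ^ 2 ∂ζ)
    {r : S × A → S × A → ℝ} (hr : Measurable (Function.uncurry r)) {C : ℝ}
    (hrC : ∀ z z', |r z z'| ≤ C) {w : E}
    (hw : ∫ p, tdIncrement f γ r w p.1 p.2 ∂(ζ ⊗ₘ saStep P pol) = 0) :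
    ∃ M m Abar a c, IsContractiveSA (saStep P pol) (tdLinear f γ) (tdIncrement f γ r w)
      M m Abar a c := by
  obtain ⟨M, hM, ⟨aM, haM⟩, hMe⟩ := exists_poisson_of_pair hρ0 hρ1 hmix
    (stronglyMeasurable_tdLinear (A := A) (γ := γ) hf) (norm_tdLinear_le hf1 hγ0)
  obtain ⟨m, hm, ⟨am, ham⟩, hme⟩ := exists_poisson_of_pair hρ0 hρ1 hmix
    (stronglyMeasurable_tdIncrement (γ := γ) hf hr w) (norm_tdIncrement_le hf1 hγ0 hrC w)
  obtain ⟨c, hc, hdrift⟩ := exists_coercive_of_inner_neg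
    (∫ p, tdLinear f γ p.1 p.2 ∂(ζ ⊗ₘ saStep P pol)) fun x hx =>
      inner_integral_tdLinear_neg hζ hγ0 hγ1 hf hf1 (hindep x hx)
  refine ⟨M, m, ∫ p, tdLinear f γ p.1 p.2 ∂(ζ ⊗ₘ saStep P pol), max 1 (max (1 + γ) (max (C + (1 + γ) * ‖w‖) (max aM am))), c, ?_⟩
  exact {
    H_meas := stronglyMeasurable_tdLinear hf
    b_meas := stronglyMeasurable_tdIncrement hf hr w
    M_meas := hM
    m_meas := hm
    one_le := le_max_left _ _
    H_le := fun z z' => (norm_tdLinear_le hf1 hγ0 z z').trans (by simp)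
    b_le := fun z z' => (norm_tdIncrement_le hf1 hγ0 hrC w z z').trans (by simp)
    M_le := fun z => (haM z).trans (by simp)
    m_le := fun z => (ham z).trans (by simp)
    c_pos := hc
    drift := hdrift
    M_eq := hMe
    m_eq := fun z => by simpa [hw] using hme z }

end TemporalDifference

/-- Uniform constants for the mean-square bound. -/
theorem IsContractiveSA.exists_rate {Z E : Type*} [MeasurableSpace Z] [NormedAddCommGroup E]
    [InnerProductSpace ℝ E] [CompleteSpace E] {K : Kernel Z Z} [IsMarkovKernel K]
    {H : Z → Z → E →L[ℝ] E} {b : Z → Z → E} {M : Z → E →L[ℝ] E} {m : Z → E}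
    {Abar : E →L[ℝ] E} {a c : ℝ} (h : IsContractiveSA K H b M m Abar a c) (x₀ : E) :
    ∃ C₀ : ℝ, ∀ C : ℝ, 1 < C → C₀ ≤ C → ∀ β : ℝ, 0 < β → β ≤ 1 / C →
      ∀ (Ω : Type*) [MeasurableSpace Ω] (μ : Measure Ω) [IsProbabilityMeasure μ]
        (z : ℕ → Ω → Z), (∀ t, Measurable (z t)) →
      (∀ t : ℕ, μ.map (fun ω => ((fun k : Fin (t + 1) => z k ω), z (t + 1) ω)) =
        (μ.map fun ω => fun k : Fin (t + 1) => z k ω) ⊗ₘ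
          K.comap (fun h : Fin (t + 1) → Z => h (Fin.last t)) (measurable_pi_apply _)) →
      ∀ t : ℕ, ∫ ω, ‖saIter H b β x₀ (fun k => z k ω) t‖ ^ 2 ∂μ ≤
        C * (1 - 1 / C * β) ^ t + C * β := by
  have ha := h.one_le
  have hc := h.c_pos
  -- The first three entries enforce the step-size conditions, `2 / c` gives `1 / C ≤ c / 2`, and
  -- the last two absorb the prefactors. Any larger `C` works too, so a single one can serve all
  -- agents.
  obtain ⟨C₀, hC₀⟩ := Finset.exists_le ({4 * a, 9 * a ^ 3 / c, c / 2, 2 / c,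
    2 * (2 * ‖x₀‖ ^ 2 + a), 2 * (a + 18 * a ^ 3 / c) + 2 * a} : Finset ℝ)
  simp only [Finset.mem_insert, Finset.mem_singleton, forall_eq_or_imp, forall_eq] at hC₀
  obtain ⟨k1, k2, k3, k4, k5, k6⟩ := hC₀
  refine ⟨C₀, fun C hC1 hC β hβ hβC Ω _ μ _ z hz hstep t => ?_⟩
  have hC0 : 0 < C := by linarith
  have hCβ : C * β ≤ 1 := by rwa [le_div_iff₀ hC0, mul_comm] at hβC
  have hle : ∀ {y : ℝ}, y ≤ C₀ → y * β ≤ 1 := fun hy =>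
    (mul_le_mul_of_nonneg_right (hy.trans hC) hβ.le).trans hCβ
  have h2 : 9 * a ^ 3 * β ≤ c := by
    have := hle k2
    rwa [div_mul_eq_mul_div, div_le_one hc] at this
  refine (h.integral_saIter_sq_le hβ.le (by nlinarith) (hle k1) h2 (hle k3) x₀ μ hz hstep
    t).trans (add_le_add ?_ (mul_le_mul_of_nonneg_right (k6.trans hC) hβ.le))
  have h3 : 1 / C ≤ c / 2 := by
    rw [div_le_div_iff₀ hC0 two_pos]
    have := k4.trans hC
    rw [div_le_iff₀ hc] at this
    linarith
  have h4 : 1 - c / 2 * β ≤ 1 - 1 / C * β := by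
    have := mul_le_mul_of_nonneg_right h3 hβ.le
    linarith
  exact mul_le_mul (k5.trans hC) (pow_le_pow_left₀ (by linarith [hle k3]) h4 t)
    (pow_nonneg (by linarith [hle k3]) t) hC0.le

/-! ### The consensus error of the critic -/

section ConsensusError

variable {N d : ℕ} {S A : Type*} {Gr : SimpleGraph (Fin N)}
  {L : Matrix (Fin N) (Fin N) ℝ} {G : ℕ} {R : Fin N → S × A → S × A → ℝ}
  {φ : Fin N → S → EuclideanSpace ℝ (Fin d)} {γ β : ℝ} {w₀ : Fin N → EuclideanSpace ℝ (Fin d)}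

theorem critic_succ (z : ℕ → S × A) (i : Fin N) (t : ℕ) :
    critic Gr L G R φ γ β w₀ z i (t + 1) = critic Gr L G R φ γ β w₀ z i t +
      β • (consensus Gr L G (fun j => R j (z t) (z (t + 1))) i • φ i (z t).1 +
        tdLinear (φ i) γ (z t) (z (t + 1)) (critic Gr L G R φ γ β w₀ z i t)) := by
  rw [tdLinear_apply, ← add_smul, smul_smul, ← add_sub_assoc]
  rfl

/-- Discrete Grönwall: the difference `e` starts at zero and satisfies `‖e'‖ ≤ (1 + (1 + γ) * β) *
‖e‖ + β * δ`, because both iterations use the same linear part. -/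
theorem norm_critic_sub_saIter_le (hγ0 : 0 ≤ γ) (hβ : 0 ≤ β) (i : Fin N)
    (hφ : ∀ s, ‖φ i s‖ ≤ 1) {r : S × A → S × A → ℝ} {δ : ℝ}
    (hδ : ∀ z z', |consensus Gr L G (fun j => R j z z') i - r z z'| ≤ δ)
    (w : EuclideanSpace ℝ (Fin d)) (z : ℕ → S × A) (t : ℕ) :
    ‖critic Gr L G R φ γ β w₀ z i t - w -
      saIter (tdLinear (φ i) γ) (tdIncrement (φ i) γ r w) β (w₀ i - w) z t‖ ≤
        δ / (1 + γ) * ((1 + (1 + γ) * β) ^ t - 1) := by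
  induction t with
  | zero => simp [critic, saIter]
  | succ t ih =>
    set x := critic Gr L G R φ γ β w₀ z i t with hx
    set y := saIter (tdLinear (φ i) γ) (tdIncrement (φ i) γ r w) β (w₀ i - w) z t with hy
    set T := tdLinear (φ i) γ (z t) (z (t + 1)) with hT
    set s := consensus Gr L G (fun j => R j (z t) (z (t + 1))) i with hs
    have heq : critic Gr L G R φ γ β w₀ z i (t + 1) - w -
        saIter (tdLinear (φ i) γ) (tdIncrement (φ i) γ r w) β (w₀ i - w) z (t + 1) =
        (x - w - y) + β • (T (x - w - y) + (s - r (z t) (z (t + 1))) • φ i (z t).1) := by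
      rw [critic_succ, saIter, saUpdate, tdIncrement_eq, ← hx, ← hy, ← hT, ← hs, map_sub,
        map_sub]
      module
    rw [heq]
    refine (norm_add_le _ _).trans ?_
    rw [norm_smul, Real.norm_of_nonneg hβ]
    have h1 : ‖T (x - w - y) + (s - r (z t) (z (t + 1))) • φ i (z t).1‖ ≤
        (1 + γ) * ‖x - w - y‖ + δ := by
      refine (norm_add_le _ _).trans (add_le_add (T.le_of_opNorm_le
        (norm_tdLinear_le hφ hγ0 _ _) _) ?_)
      rw [norm_smul, Real.norm_eq_abs]
      have := mul_le_mul (hδ (z t) (z (t + 1))) (hφ (z t).1) (norm_nonneg _)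
        ((abs_nonneg _).trans (hδ (z t) (z (t + 1))))
      linarith
    have h2 := mul_le_mul_of_nonneg_left h1 hβ
    have h3 := mul_le_mul_of_nonneg_right ih (by positivity : 0 ≤ 1 + (1 + γ) * β)
    refine (add_le_add le_rfl h2).trans ((le_of_eq (by ring :
      _ = ‖x - w - y‖ * (1 + (1 + γ) * β) + β * δ)).trans
      ((add_le_add h3 le_rfl).trans (le_of_eq ?_)))
    have hγ : 1 + γ ≠ 0 := by positivity
    field_simp
    ring

theorem measurable_critic [MeasurableSpace S] [MeasurableSpace A] {ν : ℝ}
    (hL : IsConsensusMatrix Gr L ν) (hR : ∀ i, Measurable (Function.uncurry (R i)))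
    (hφ : ∀ i, Measurable (φ i)) {Ω : Type*} [MeasurableSpace Ω] {z : ℕ → Ω → S × A}
    (hz : ∀ t, Measurable (z t)) (i : Fin N) (t : ℕ) :
    Measurable fun ω => critic Gr L G R φ γ β w₀ (fun k => z k ω) i t := by
  induction t with
  | zero => exact measurable_const
  | succ t ih =>
    simp_rw [critic_succ]
    have hr : Measurable fun ω =>
        consensus Gr L G (fun j => R j (z t ω) (z (t + 1) ω)) i := by
      simp_rw [consensus_eq_mulVec hL, Matrix.mulVec, dotProduct]
      exact Finset.measurable_fun_sum _ fun j _ =>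
        ((hR j).comp ((hz t).prodMk (hz (t + 1)))).const_mul _
    have hf : Measurable fun ω => φ i (z t ω).1 := (hφ i).comp (measurable_fst.comp (hz t))
    have hT := stronglyMeasurable_clm_apply ((stronglyMeasurable_tdLinear (γ := γ)
      (hφ i)).comp_measurable ((hz t).prodMk (hz (t + 1)))) ih.stronglyMeasurable
    have hrf := hr.stronglyMeasurable.smul hf.stronglyMeasurable
    exact (ih.stronglyMeasurable.add ((hrf.add hT).const_smul β)).measurable

end ConsensusError

end DecMARL

end

/-! ### The finite-time bound: combining consensus error and ideal TD error. -/

theorem theorem1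
    -- the multi-agent MDP: `N` agents, states, local action sets, transition law
    {N : ℕ} (hN : 2 ≤ N) {S : Type*} [MeasurableSpace S]
    {A : Fin N → Type*} [∀ i, MeasurableSpace (A i)]
    (P : Kernel (S × (∀ i, A i)) S) [IsMarkovKernel P]
    -- bounded local rewards `R i (s, a) (s', a')` of a transition `(s, a) → (s', a')`
    (R : Fin N → S × (∀ i, A i) → S × (∀ i, A i) → ℝ)
    (hR : ∀ i, Measurable (Function.uncurry (R i)))
    (rmax : ℝ) (hrmax : 0 < rmax) (hRbound : ∀ i z z', |R i z z'| ≤ rmax)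
    -- discount factor
    (γ : ℝ) (hγ0 : 0 ≤ γ) (hγ1 : γ < 1)
    -- the given joint policy, its stationary distribution, and geometric mixing
    (pol : Kernel S (∀ i, A i)) [IsMarkovKernel pol]
    (ζ : Measure (S × (∀ i, A i))) [IsProbabilityMeasure ζ]
    (hζ : Kernel.Invariant (DecMARL.saStep P pol) ζ)
    (κ ρ : ℝ) (hκ : 0 < κ) (hρ0 : 0 < ρ) (hρ1 : ρ < 1)
    (hmix : ∀ (t : ℕ) (s : S), DecMARL.tvDist (DecMARL.saLaw P pol t s) ζ ≤ κ * ρ ^ t)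
    -- normalized, linearly independent features, and initial critic parameters
    {d : ℕ} (φ : Fin N → S → EuclideanSpace ℝ (Fin d)) (hφ : ∀ i, Measurable (φ i))
    (hφbound : ∀ i s, ‖φ i s‖ ≤ 1)
    (hφindep : ∀ i, ∀ u : EuclideanSpace ℝ (Fin d), u ≠ 0 →
      0 < ∫ z, (inner ℝ (φ i z.1) u) ^ 2 ∂ζ)
    (w₀ : Fin N → EuclideanSpace ℝ (Fin d)) :
    -- the mixing time is `O(log β⁻¹)`
    ((fun β : ℝ => (DecMARL.mixingTime P pol ζ β : ℝ)) =O[𝓝[>] 0] fun β : ℝ => Real.log (β⁻¹)) ∧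
    -- every agent has exactly one TD fixed point
    (∀ i, ∃! w, DecMARL.IsTDFixedPoint P pol ζ R (φ i) γ w) ∧
    -- and the critics approach it at the stated rate
    ∃ β₀ c₅ c₆ c₇ : ℝ, 0 < β₀ ∧ 0 < c₅ ∧ 0 < c₆ ∧ 0 < c₇ ∧ c₆ * β₀ < 1 ∧
      ∀ (Gr : SimpleGraph (Fin N)) (L : Matrix (Fin N) (Fin N) ℝ) (ν : ℝ), Gr.Connected →
        DecMARL.IsConsensusMatrix Gr L ν →
      ∀ (Ω : Type*) [MeasurableSpace Ω] (μ : Measure Ω) [IsProbabilityMeasure μ]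
        (z : ℕ → Ω → S × (∀ i, A i)), DecMARL.IsTrajectory P pol μ z →
      ∀ β : ℝ, 0 < β → β ≤ β₀ → ∀ (G t : ℕ) (i : Fin N) (wstar : EuclideanSpace ℝ (Fin d)),
        DecMARL.IsTDFixedPoint P pol ζ R (φ i) γ wstar →
        let w := fun ω => DecMARL.critic Gr L G R φ γ β w₀ (fun k => z k ω) i t
        let c₁ := 2 * β * N * rmax * (1 + (ν ^ (N - 1))⁻¹)
        let c₂ := Real.log ((1 - ν ^ (N - 1))⁻¹)
        let c₃ := (1 + γ) * β
        let c₄ := Real.log (1 + (1 + γ) * β)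
        let τ := DecMARL.mixingTime P pol ζ β
        Integrable (fun ω => ‖w ω - wstar‖ ^ 2) μ ∧
        ∫ ω, ‖w ω - wstar‖ ^ 2 ∂μ ≤
          2 * (c₁ / c₃) ^ 2 * Real.exp (-2 * c₂ * G + 2 * c₄ * t)
            + 2 * c₅ * (1 - c₆ * β) ^ ((t : ℤ) - (τ : ℤ)) + 2 * c₇ * τ * β := by
  have hN0 : (0 : ℝ) < N := by exact_mod_cast (by omega : 0 < N)
  let r : S × (∀ i, A i) → S × (∀ i, A i) → ℝ := fun z z' => (∑ j, R j z z') / N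
  have hr : Measurable (Function.uncurry r) :=
    (Finset.measurable_fun_sum _ fun j _ => hR j).div_const _
  have hrC : ∀ z z', |r z z'| ≤ rmax := fun z z' => by
    rw [abs_div, abs_of_pos hN0, div_le_iff₀ hN0]
    refine (Finset.abs_sum_le_sum_abs _ _).trans
      ((Finset.sum_le_sum fun j _ => hRbound j z z').trans (le_of_eq ?_))
    simp [mul_comm]
  have hunique : ∀ i, ∃! w, DecMARL.IsTDFixedPoint P pol ζ R (φ i) γ w := fun i =>
    DecMARL.existsUnique_integral_tdIncrement_eq_zero hζ hγ0 hγ1 (hφ i) (hφbound i)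
      (hφindep i) hr hrC
  refine ⟨DecMARL.mixingTime_isBigO_log hκ hρ0 hρ1 hmix, hunique, ?_⟩
  choose ws hws hwsu using hunique
  choose M m Abar a c hSA using fun i => DecMARL.exists_isContractiveSA hρ0 hρ1 hmix hζ hγ0 hγ1
    (hφ i) (hφbound i) (hφindep i) hr hrC (hws i)
  choose C₀ hC₀ using fun i => (hSA i).exists_rate (w₀ i - ws i)
  obtain ⟨C₁, hC₁⟩ := (Finset.univ.image C₀).exists_le
  obtain ⟨C, hC1, hCC⟩ : ∃ C : ℝ, 1 < C ∧ ∀ i, C₀ i ≤ C :=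
    ⟨max C₁ 2, by simp, fun i => (hC₁ _ (Finset.mem_image_of_mem _ (Finset.mem_univ i))).trans (le_max_left _ _)⟩
  have hCpos : 0 < C := by linarith
  -- `C` depends only on the chain, rewards, features, discount and initial parameters, and is fixed
  -- before the graph, the weights and the trajectory; `1 < C` gives `c₆ * β₀ = 1 / C² < 1`.
  refine ⟨1 / C, C, 1 / C, C, by positivity, hCpos, by positivity, hCpos, ?_, ?_⟩
  · rw [div_mul_div_comm, div_lt_one (by positivity)]
    nlinarith
  intro Gr L ν hGr hL Ω _ μ _ z hz β hβ hβC G t i wstar hwstar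
  obtain rfl : wstar = ws i := hwsu i wstar hwstar
  intro w c₁ c₂ c₃ c₄ τ
  have hε1 : ν ^ (N - 1) < 1 := pow_lt_one₀ hL.pos.le
    (by linarith [hL.le_half hN hGr]) (by omega)
  have hε0 : 0 < ν ^ (N - 1) := pow_pos hL.pos _
  set δ := 4 * rmax * (1 - ν ^ (N - 1)) ^ G with hδ
  let y : Ω → EuclideanSpace ℝ (Fin d) := fun ω =>
    DecMARL.saIter (DecMARL.tdLinear (φ i) γ) (DecMARL.tdIncrement (φ i) γ r (ws i)) β
      (w₀ i - ws i) (fun k => z k ω) t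
  have herr : ∀ ω, ‖w ω - ws i - y ω‖ ≤ c₁ / c₃ * Real.exp (-c₂ * G + c₄ * t) := fun ω => by
    refine (DecMARL.norm_critic_sub_saIter_le hγ0 hβ.le i (hφbound i) (δ := δ)
      (fun z z' => hL.abs_consensus_sub_le hN hGr hrmax (fun j => hRbound j z z') G i)
      (ws i) _ t).trans ?_
    have hq : 0 < 1 + (1 + γ) * β := by positivity
    have hexp : Real.exp (-c₂ * G + c₄ * t) =
        (1 - ν ^ (N - 1)) ^ G * (1 + (1 + γ) * β) ^ t := by
      rw [Real.exp_add, mul_comm, mul_comm c₄, Real.exp_nat_mul, Real.exp_log hq, mul_comm (-c₂),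
        Real.exp_nat_mul, ← Real.log_inv, inv_inv, Real.exp_log (by linarith), mul_comm]
    have hc : c₁ / c₃ = 2 * N * rmax * (1 + (ν ^ (N - 1))⁻¹) / (1 + γ) := by
      have : 1 + γ ≠ 0 := by positivity
      simp only [c₁, c₃]
      field_simp
    have hpow : 0 ≤ (1 - ν ^ (N - 1)) ^ G := pow_nonneg (by linarith) _
    -- The stated `c₁` has room to spare: `N ≥ 2` alone covers the constant `4 * rmax`.
    have h4 : 4 * rmax ≤ 2 * N * rmax * (1 + (ν ^ (N - 1))⁻¹) := by
      have h5 : (2 : ℝ) ≤ N := by exact_mod_cast hN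
      have h6 : 0 ≤ (ν ^ (N - 1))⁻¹ := by positivity
      calc 4 * rmax = 2 * 2 * rmax * 1 := by ring
        _ ≤ 2 * N * rmax * (1 + (ν ^ (N - 1))⁻¹) := by gcongr; linarith
    rw [hexp, hc, hδ]
    calc 4 * rmax * (1 - ν ^ (N - 1)) ^ G / (1 + γ) * ((1 + (1 + γ) * β) ^ t - 1)
        ≤ 4 * rmax * (1 - ν ^ (N - 1)) ^ G / (1 + γ) * (1 + (1 + γ) * β) ^ t := by
          gcongr; linarith
      _ ≤ 2 * N * rmax * (1 + (ν ^ (N - 1))⁻¹) * (1 - ν ^ (N - 1)) ^ G / (1 + γ) *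
          (1 + (1 + γ) * β) ^ t := by gcongr
      _ = _ := by ring
  have hsq : ∀ ω, ‖w ω - ws i‖ ^ 2 ≤
      2 * (c₁ / c₃) ^ 2 * Real.exp (-2 * c₂ * G + 2 * c₄ * t) + 2 * ‖y ω‖ ^ 2 := fun ω => by
    have h1 : ‖w ω - ws i‖ ≤ ‖w ω - ws i - y ω‖ + ‖y ω‖ := by
      simpa using norm_add_le (w ω - ws i - y ω) (y ω)
    have h2 := pow_le_pow_left₀ (norm_nonneg _) h1 2
    have h3 := pow_le_pow_left₀ (norm_nonneg _) (herr ω) 2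
    rw [mul_pow, ← Real.exp_nat_mul] at h3
    rw [show -2 * c₂ * G + 2 * c₄ * t = ((2 : ℕ) : ℝ) * (-c₂ * G + c₄ * t) by push_cast; ring]
    nlinarith [sq_nonneg (‖w ω - ws i - y ω‖ - ‖y ω‖)]
  have iy : Integrable (fun ω => ‖y ω‖ ^ 2) μ :=
    (hSA i).integrable_saIter_sq β (w₀ i - ws i) μ hz.measurable t
  have hwm : Measurable w := DecMARL.measurable_critic hL hR hφ hz.measurable i t
  have iw : Integrable (fun ω => ‖w ω - ws i‖ ^ 2) μ := by
    refine ((integrable_const (2 * (c₁ / c₃) ^ 2 *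
      Real.exp (-2 * c₂ * G + 2 * c₄ * t))).add (iy.const_mul 2)).mono' (((hwm.sub_const (ws i)).norm.pow_const 2).aestronglyMeasurable) (ae_of_all _ fun ω => ?_)
    rw [Real.norm_of_nonneg (sq_nonneg _)]
    exact hsq ω
  refine ⟨iw, ?_⟩
  have hint := integral_mono iw ((integrable_const _).add (iy.const_mul 2)) hsq
  rw [integral_add' (integrable_const _) (iy.const_mul 2)] at hint
  simp only [integral_const, probReal_univ, one_smul] at hint
  rw [integral_const_mul] at hint
  have hrate := hC₀ i C hC1 (hCC i) β hβ hβC Ω μ z hz.measurable hz.step t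
  have hτ : (1 : ℝ) ≤ τ := by
    exact_mod_cast DecMARL.one_le_mixingTime hκ hρ0 hρ1 hmix hβ
  have hb1 : 1 / C * β < 1 := by
    have h1 : 1 / C * β ≤ 1 / C * (1 / C) := mul_le_mul_of_nonneg_left hβC (by positivity)
    have h2 : 1 / C < 1 := (div_lt_one hCpos).2 hC1
    have h3 : 0 < 1 / C := by positivity
    nlinarith
  have hb0 : 0 < 1 / C * β := by positivity
  -- The exponent `t - τ` is an integer and may be negative; lowering the exponent of a base in `(0,
  -- 1)` only increases the power.
  have hz1 : (1 - 1 / C * β) ^ t ≤ (1 - 1 / C * β) ^ ((t : ℤ) - (τ : ℤ)) := by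
    rw [← zpow_natCast]
    exact zpow_le_zpow_right_of_le_one₀ (by linarith) (by linarith) (by omega)
  have h1 := mul_le_mul_of_nonneg_left hz1 hCpos.le
  have h2 : C * β ≤ C * τ * β := by
    have := mul_le_mul_of_nonneg_left hτ (mul_pos hCpos hβ).le
    linarith
  change ∫ ω, ‖y ω‖ ^ 2 ∂μ ≤ _ at hrate
  linarith
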